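/- Let $\Bbbk$ be an algebraically closed field of characteristic $0$, let $G_2$ be the simple algebraic group of type $\mathsf G_2$ over $\Bbbk$ (the automorphism group of the octonion algebra over $\Bbbk$), and let $\varpi_1$ be its simple $7$-dimensional module (the octonions of trace zero). Let $v_1\in\varpi_1$ be a highest weight vector, that is, a non-zero vector which is a common eigenvector of some Borel subalgebra of $\operatorname{Lie} G_2$. Let $Q=(G_2)_{v_1}=\{g\in G_2\mid g\cdot v_1=v_1\}$ be its isotropy group and $\mathfrak q=\operatorname{Lie}Q$. The symmetric algebra $\mathcal S(\mathfrak q)$ is identified with the algebra $\Bbbk[\mathfrak q^*]$ of polynomial functions on $\mathfrak q^*$, on which $Q$ acts through the coadjoint representation. Then: (i) $\mathfrak q$ has the codim-$2$ property: if $\mathfrak q^*_{\rm reg}$ denotes the set of $\eta\in\mathfrak q^*$ such that $\dim Q\cdot\eta\ge\dim Q\cdot\eta'$ for all $\eta'\in\mathfrak q^*$, then $\operatorname{codim}(\mathfrak q^*\setminus\mathfrak q^*_{\rm reg})\ge 2$. (ii) The algebra $\mathcal S(\mathfrak q)^Q=\Bbbk[\mathfrak q^*]^Q$ is a polynomial ring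 in two variables whose basic invariants (algebraically independent homogeneous generators) have degrees $2$ and $3$. More explicitly, $\mathfrak q$ has a basis $e,h,f,a_1,b_1,u,a_2,b_2$ with the following properties. The elements $e,h,f$ form a standard basis of a subalgebra $\mathfrak{sl}_2$, that is, $[e,f]=h$, $[h,e]=2e$, $[h,f]=-2f$. For $i=1,2$ the pair $a_i,b_i$ spans a standard $\mathfrak{sl}_2$-module, that is, $[e,a_i]=0$, $[f,a_i]=b_i$, $[h,a_i]=a_i$, $[e,b_i]=a_i$, $[f,b_i]=0$, $[h,b_i]=-b_i$. The element $u$ commutes with $e,h,f$. Finally $[a_1,b_1]=u$, $[a_1,u]=a_2$, $[b_1,u]=b_2$, and all other brackets among $a_1,b_1,u,a_2,b_2$ vanish. Thus $\mathfrak q=\mathfrak{sl}_2\ltimes\mathfrak n$, where $\mathfrak n=\langle a_1,b_1\rangle\oplus\langle u\rangle\oplus\langle a_2,b_2\rangle$ is a $5$-dimensional nilpotent Lie algebra graded in degrees $1,2,3$. With respect to this basis, $$\mathbf h_1=2a_1b_2-2b_1a_2+u^2,\qquad \mathbf h_2=b_2^2e+a_2b_2h-a_2^2f+u(a_1b_2-a_2b_1)+\tfrac13u^3$$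 are algebraically independent and generate $\mathcal S(\mathfrak q)^Q$. -/

import Mathlib

open scoped Matrix

attribute [local instance 100] LieRing.ofAssociativeRing

noncomputable section

namespace G2Case

/-! ### Linear groups and their Lie algebras -/

section LinearGroups

set_option linter.unusedSectionVars false

variable {n : Type*} [Fintype n] [DecidableEq n] {k : Type*} [Field k]

/-- The value at the matrix `M` of a polynomial `f` in the matrix entries. -/
def evalAt (M : Matrix n n k) : MvPolynomial (n × n) k →ₐ[k] k :=
  MvPolynomial.aeval fun p => M p.1 p.2

/-- The derivative of the polynomial function `f` at the matrix `M` in the direction `X`. -/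
def dirDeriv (M X : Matrix n n k) (f : MvPolynomial (n × n) k) : k :=
  ∑ p : n × n, X p.1 p.2 * evalAt M (MvPolynomial.pderiv p f)

/-- The ideal of all polynomials in the matrix entries that vanish on the group `Q`. -/
def idealOf (Q : Subgroup (GL n k)) : Ideal (MvPolynomial (n × n) k) where
  carrier := {f | ∀ g ∈ Q, evalAt (g : Matrix n n k) f = 0}
  zero_mem' _ _ := map_zero _
  add_mem' {f f'} hf hf' g hg := by rw [map_add, hf g hg, hf' g hg, add_zero]
  smul_mem' c f hf g hg := by rw [smul_eq_mul, map_mul, hf g hg, mul_zero]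

lemma mem_idealOf {Q : Subgroup (GL n k)} {f : MvPolynomial (n × n) k} :
    f ∈ idealOf Q ↔ ∀ g ∈ Q, evalAt (g : Matrix n n k) f = 0 := Iff.rfl

lemma dirDeriv_add (M X : Matrix n n k) (f f' : MvPolynomial (n × n) k) :
    dirDeriv M X (f + f') = dirDeriv M X f + dirDeriv M X f' := by
  simp [dirDeriv, mul_add, Finset.sum_add_distrib]

lemma dirDeriv_mul (M X : Matrix n n k) (f f' : MvPolynomial (n × n) k) :
    dirDeriv M X (f * f') = evalAt M f * dirDeriv M X f' + evalAt M f' * dirDeriv M X f := by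
  simp only [dirDeriv, Derivation.leibniz, map_add, smul_eq_mul, map_mul, Finset.mul_sum]
  rw [← Finset.sum_add_distrib]
  exact Finset.sum_congr rfl fun _ _ => by ring

lemma dirDeriv_C (M X : Matrix n n k) (c : k) : dirDeriv M X (MvPolynomial.C c) = 0 := by
  simp [dirDeriv]

lemma dirDeriv_X (M X : Matrix n n k) (q : n × n) :
    dirDeriv M X (MvPolynomial.X q) = X q.1 q.2 := by
  simp only [dirDeriv, MvPolynomial.pderiv_X, Pi.single_apply]
  rw [Finset.sum_eq_single q]
  · simp
  · intro b _ hb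
    simp [Ne.symm hb]
  · simp

lemma dirDeriv_smul_add (M X Y : Matrix n n k) (c : k) (f : MvPolynomial (n × n) k) :
    dirDeriv M (c • X + Y) f = c * dirDeriv M X f + dirDeriv M Y f := by
  simp only [dirDeriv, Matrix.add_apply, Matrix.smul_apply, smul_eq_mul, add_mul,
    Finset.sum_add_distrib, Finset.mul_sum, mul_assoc]

/-- Composition of a polynomial function with a linear map of the space of matrices. -/
def pull (L : Matrix n n k →ₗ[k] Matrix n n k) :
    MvPolynomial (n × n) k →ₐ[k] MvPolynomial (n × n) k :=
  MvPolynomial.aeval fun p =>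
    ∑ q : n × n, MvPolynomial.C (L (Matrix.single q.1 q.2 1) p.1 p.2) * MvPolynomial.X q

lemma sum_single (L : Matrix n n k →ₗ[k] Matrix n n k) (M : Matrix n n k) (i j : n) :
    ∑ q : n × n, L (Matrix.single q.1 q.2 1) i j * M q.1 q.2 = L M i j := by
  conv_rhs => rw [Matrix.matrix_eq_sum_single M]
  rw [Fintype.sum_prod_type]
  simp only [map_sum, Matrix.sum_apply]
  refine Finset.sum_congr rfl fun a _ => Finset.sum_congr rfl fun b _ => ?_
  have : Matrix.single a b (M a b) = M a b • Matrix.single a b (1 : k) := by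
    simp [Matrix.smul_single]
  rw [this, map_smul, Matrix.smul_apply, smul_eq_mul, mul_comm]

lemma evalAt_pull (L : Matrix n n k →ₗ[k] Matrix n n k) (M : Matrix n n k)
    (f : MvPolynomial (n × n) k) : evalAt M (pull L f) = evalAt (L M) f := by
  induction f using MvPolynomial.induction_on with
  | C a => simp [pull, evalAt]
  | add p q hp hq => simp [hp, hq]
  | mul_X p q hp =>
    rw [map_mul, map_mul, map_mul, hp]
    congr 1
    simp [pull, evalAt, sum_single]

lemma dirDeriv_pull (L : Matrix n n k →ₗ[k] Matrix n n k) (M X : Matrix n n k)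
    (f : MvPolynomial (n × n) k) : dirDeriv M X (pull L f) = dirDeriv (L M) (L X) f := by
  induction f using MvPolynomial.induction_on with
  | C a =>
    have : pull L (MvPolynomial.C a) = MvPolynomial.C a := by simp [pull]
    rw [this, dirDeriv_C, dirDeriv_C]
  | add p q hp hq => rw [map_add, dirDeriv_add, dirDeriv_add, hp, hq]
  | mul_X p q hp =>
    rw [map_mul, dirDeriv_mul, dirDeriv_mul, hp, evalAt_pull, evalAt_pull, dirDeriv_X]
    congr 2
    have h : ∀ s : Finset (n × n), dirDeriv M X (∑ r ∈ s,
        MvPolynomial.C (L (Matrix.single r.1 r.2 1) q.1 q.2) * MvPolynomial.X r)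
        = ∑ r ∈ s, L (Matrix.single r.1 r.2 1) q.1 q.2 * X r.1 r.2 := by
      intro s
      induction s using Finset.induction_on with
      | empty => simp [dirDeriv]
      | insert a s ha ih =>
        rw [Finset.sum_insert ha, Finset.sum_insert ha, dirDeriv_add, ih, dirDeriv_mul,
          dirDeriv_C, dirDeriv_X]
        simp [evalAt]
    simp only [pull, MvPolynomial.aeval_X]
    rw [h, sum_single]

/-- The left invariant derivation of the algebra of polynomials attached to `X`. -/
def leftInv (X : Matrix n n k) :
    Derivation k (MvPolynomial (n × n) k) (MvPolynomial (n × n) k) :=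
  MvPolynomial.mkDerivation k fun p =>
    ∑ l : n, MvPolynomial.C (X l p.2) * MvPolynomial.X (p.1, l)

lemma evalAt_leftInv (M X : Matrix n n k) (f : MvPolynomial (n × n) k) :
    evalAt M (leftInv X f) = dirDeriv M (M * X) f := by
  induction f using MvPolynomial.induction_on with
  | C a => rw [dirDeriv_C]; simp [leftInv, MvPolynomial.derivation_C]
  | add p q hp hq => rw [map_add, map_add, dirDeriv_add, hp, hq]
  | mul_X p q hp =>
    rw [dirDeriv_mul, Derivation.leibniz, map_add, smul_eq_mul, smul_eq_mul, map_mul, map_mul,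
      hp, dirDeriv_X]
    congr 2
    simp only [leftInv, MvPolynomial.mkDerivation_X, Matrix.mul_apply]
    simp [evalAt, mul_comm]

lemma leftInv_lie (X Y : Matrix n n k) (f : MvPolynomial (n × n) k) :
    leftInv ⁅X, Y⁆ f = leftInv X (leftInv Y f) - leftInv Y (leftInv X f) := by
  have key : leftInv ⁅X, Y⁆ = ⁅leftInv X, leftInv Y⁆ := by
    refine MvPolynomial.derivation_ext fun p => ?_
    rw [Derivation.commutator_apply]
    simp only [leftInv, MvPolynomial.mkDerivation_X, map_sum, Derivation.leibniz,
      MvPolynomial.derivation_C, smul_eq_mul, mul_zero, add_zero, Ring.lie_def,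
      Matrix.sub_apply, Matrix.mul_apply, Finset.mul_sum, MvPolynomial.C_sub, sub_mul,
      Finset.sum_sub_distrib, Finset.sum_mul, MvPolynomial.C_mul]
    congr 1
    · rw [Finset.sum_comm]
      exact Finset.sum_congr rfl fun _ _ => Finset.sum_congr rfl fun _ _ => by ring
    · rw [Finset.sum_comm]
      exact Finset.sum_congr rfl fun _ _ => Finset.sum_congr rfl fun _ _ => by ring
  rw [key, Derivation.commutator_apply]

lemma leftInv_mem {Q : Subgroup (GL n k)} {X : Matrix n n k}
    (hX : ∀ f ∈ idealOf Q, dirDeriv 1 X f = 0) {f : MvPolynomial (n × n) k}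
    (hf : f ∈ idealOf Q) : leftInv X f ∈ idealOf Q := by
  intro g hg
  rw [evalAt_leftInv]
  have h : pull (LinearMap.mulLeft k (g : Matrix n n k)) f ∈ idealOf Q := by
    intro g' hg'
    rw [evalAt_pull]
    simpa using hf (g * g') (Q.mul_mem hg hg')
  have := hX _ h
  rw [dirDeriv_pull] at this
  simpa using this

/-- The Lie algebra of an algebraic group `Q ⊆ GL n k`: the tangent space to `Q` at the identity,
i.e. all matrices `X` such that the derivative at `1` in the direction `X` of every polynomial
vanishing on `Q` is zero, with the commutator bracket. -/
def lieAlg (Q : Subgroup (GL n k)) : LieSubalgebra k (Matrix n n k) where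
  carrier := {X | ∀ f ∈ idealOf Q, dirDeriv 1 X f = 0}
  zero_mem' f _ := by simp [dirDeriv]
  add_mem' {X Y} hX hY f hf := by
    have := dirDeriv_smul_add 1 X Y 1 f
    rw [one_smul, hX f hf, hY f hf] at this
    simpa using this
  smul_mem' c X hX f hf := by
    have := dirDeriv_smul_add 1 X 0 c f
    rw [add_zero, hX f hf] at this
    rw [this]
    simp [dirDeriv]
  lie_mem' {X Y} hX hY f hf := by
    have h := evalAt_leftInv 1 ⁅X, Y⁆ f
    rw [one_mul, leftInv_lie, map_sub, evalAt_leftInv, evalAt_leftInv, one_mul, one_mul,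
      hX _ (leftInv_mem hY hf), hY _ (leftInv_mem hX hf), sub_zero] at h
    exact h.symm

lemma conj_mem_lieAlg {Q : Subgroup (GL n k)} {g : GL n k} (hg : g ∈ Q) {X : Matrix n n k}
    (hX : X ∈ lieAlg Q) :
    (g : Matrix n n k) * X * ((g⁻¹ : GL n k) : Matrix n n k) ∈ lieAlg Q := by
  intro f hf
  let L : Matrix n n k →ₗ[k] Matrix n n k :=
    LinearMap.mulRight k ((g⁻¹ : GL n k) : Matrix n n k) ∘ₗ
      LinearMap.mulLeft k (g : Matrix n n k)
  have h : pull L f ∈ idealOf Q := by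
    intro g' hg'
    rw [evalAt_pull]
    simpa [L] using hf (g * g' * g⁻¹) (Q.mul_mem (Q.mul_mem hg hg') (Q.inv_mem hg))
  have := hX _ h
  rw [dirDeriv_pull] at this
  have h1 : L 1 = 1 := by
    simp only [L, LinearMap.comp_apply, LinearMap.mulLeft_apply, LinearMap.mulRight_apply, mul_one]
    exact g.mul_inv
  rw [h1] at this
  exact this

/-- The adjoint representation `Ad g : X ↦ g X g⁻¹` of an algebraic group `Q ⊆ GL n k` on its
Lie algebra. -/
def adjointRep (Q : Subgroup (GL n k)) : Representation k Q (lieAlg Q) where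
  toFun g :=
    { toFun := fun X => ⟨((g : GL n k) : Matrix n n k) * X * (((g : GL n k)⁻¹ : GL n k) :
        Matrix n n k), conj_mem_lieAlg g.2 X.2⟩
      map_add' := fun X Y => Subtype.ext (by simp [mul_add, add_mul])
      map_smul' := fun c X => Subtype.ext (by simp) }
  map_one' := by
    ext X : 2
    simp
  map_mul' g h := by
    ext X : 2
    simp [mul_assoc]

/-- The coadjoint representation of `Q` on the dual space of its Lie algebra: the dual of the
adjoint representation. -/
def coadjointRep (Q : Subgroup (GL n k)) : Representation k Q (Module.Dual k (lieAlg Q)) :=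
  (adjointRep Q).dual

end LinearGroups

/-! ### Polynomial functions on a dual space and Zariski dimension -/

section Dimension

variable {k : Type*} [Field k] {V : Type*} [AddCommGroup V] [Module k V]

/-- Elements of the symmetric algebra of `V` as polynomial functions on `V*`: the value at `ξ`. -/
def evalDual (ξ : Module.Dual k V) : SymmetricAlgebra k V →ₐ[k] k :=
  SymmetricAlgebra.lift ξ

/-- The ideal of polynomial functions on `V*` that vanish on the set `Z`. -/
def vanishing (Z : Set (Module.Dual k V)) : Ideal (SymmetricAlgebra k V) :=
  ⨅ ξ ∈ Z, RingHom.ker (evalDual ξ)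

/-- The dimension of (the Zariski closure of) a subset `Z` of `V*`: the Krull dimension of its
coordinate ring; it is `⊥` for the empty set. -/
def zariskiDim (Z : Set (Module.Dual k V)) : WithBot ℕ∞ :=
  ringKrullDim (SymmetricAlgebra k V ⧸ vanishing Z)

/-- The homogeneous elements of degree `d` of the symmetric algebra. -/
def homogeneousPart (k V : Type*) [Field k] [AddCommGroup V] [Module k V] (d : ℕ) :
    Submodule k (SymmetricAlgebra k V) :=
  LinearMap.range (SymmetricAlgebra.ι k V) ^ d

end Dimension

/-! ### Coadjoint orbits, the codim-2 property, and invariants -/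

section Coadjoint

variable {n : Type*} [Fintype n] [DecidableEq n] {k : Type*} [Field k]

/-- The coadjoint orbit of `η`. -/
def coadjointOrbit (Q : Subgroup (GL n k)) (η : Module.Dual k (lieAlg Q)) :
    Set (Module.Dual k (lieAlg Q)) :=
  Set.range fun g : Q => coadjointRep Q g η

/-- The regular elements of the dual of the Lie algebra: those whose coadjoint orbit has the
maximal dimension. -/
def regularSet (Q : Subgroup (GL n k)) : Set (Module.Dual k (lieAlg Q)) :=
  {η | ∀ η', zariskiDim (coadjointOrbit Q η') ≤ zariskiDim (coadjointOrbit Q η)}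

/-- The codim-2 property: the set of non-regular elements of the dual of the Lie algebra has
codimension at least two. -/
def HasCodimTwoProperty (Q : Subgroup (GL n k)) : Prop :=
  zariskiDim (regularSet Q)ᶜ + 2 ≤ zariskiDim (Set.univ : Set (Module.Dual k (lieAlg Q)))

/-- The algebra of polynomial functions on the dual of the Lie algebra (elements of the symmetric
algebra) that are invariant under the coadjoint representation of `Q`. -/
def coadjointInvariants (Q : Subgroup (GL n k)) :
    Subalgebra k (SymmetricAlgebra k (lieAlg Q)) where
  carrier := {F | ∀ (g : Q) (ξ : Module.Dual k (lieAlg Q)),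
    evalDual (coadjointRep Q g ξ) F = evalDual ξ F}
  mul_mem' hF hF' g ξ := by rw [map_mul, map_mul, hF g ξ, hF' g ξ]
  add_mem' hF hF' g ξ := by rw [map_add, map_add, hF g ξ, hF' g ξ]
  algebraMap_mem' r g ξ := by rw [AlgHom.commutes, AlgHom.commutes]

/-- A Borel subalgebra: a maximal solvable subalgebra. -/
def IsBorel {L : Type*} [LieRing L] [LieAlgebra k L] (b : LieSubalgebra k L) : Prop :=
  Maximal (fun c : LieSubalgebra k L => LieAlgebra.IsSolvable c) b

/-- A vector of `kⁿ` is a highest weight vector of `G ⊆ GL n k` if it is non-zero and it is a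
common eigenvector of some Borel subalgebra of the Lie algebra of `G`. -/
def IsHighestWeightVector (G : Subgroup (GL n k)) (v : n → k) : Prop :=
  v ≠ 0 ∧ ∃ b : LieSubalgebra k (lieAlg G), IsBorel b ∧
    ∀ X ∈ b, ∃ c : k, (X : Matrix n n k) *ᵥ v = c • v

/-- The isotropy group of the vector `v` in `G`. -/
def isotropy (G : Subgroup (GL n k)) (v : n → k) : Subgroup (GL n k) where
  carrier := {g | g ∈ G ∧ (g : Matrix n n k) *ᵥ v = v}
  one_mem' := ⟨G.one_mem, by simp⟩
  mul_mem' {g h} hg hh := ⟨G.mul_mem hg.1 hh.1, by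
    rw [Units.val_mul, ← Matrix.mulVec_mulVec, hh.2, hg.2]⟩
  inv_mem' {g} hg := ⟨G.inv_mem hg.1, by
    have h : ((g⁻¹ : GL n k) : Matrix n n k) * (g : Matrix n n k) = 1 := g.inv_mul
    conv_lhs => rw [← hg.2]
    rw [Matrix.mulVec_mulVec, h, Matrix.one_mulVec]⟩

end Coadjoint

/-! ### The group of type `G₂` and its seven-dimensional module -/

section G2

variable {k : Type*} [Field k]

/-- The product of the split octonions over `k` in Zorn's vector-matrix form. The vector
`x = (α, u₁, u₂, u₃, w₁, w₂, w₃, β)` stands for the vector matrix with scalars `α, β` on the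
diagonal and vectors `u, w` off it, and
`(α, u, w, β) (α', u', w', β') =
  (α α' + u ⬝ w', α u' + β' u - w × w', α' w + β w' + u × u', β β' + w ⬝ u')`. -/
def octMul (x y : Fin 8 → k) : Fin 8 → k :=
  ![x 0 * y 0 + (x 1 * y 4 + x 2 * y 5 + x 3 * y 6),
    x 0 * y 1 + y 7 * x 1 - (x 5 * y 6 - x 6 * y 5),
    x 0 * y 2 + y 7 * x 2 - (x 6 * y 4 - x 4 * y 6),
    x 0 * y 3 + y 7 * x 3 - (x 4 * y 5 - x 5 * y 4),
    y 0 * x 4 + x 7 * y 4 + (x 2 * y 3 - x 3 * y 2),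
    y 0 * x 5 + x 7 * y 5 + (x 3 * y 1 - x 1 * y 3),
    y 0 * x 6 + x 7 * y 6 + (x 1 * y 2 - x 2 * y 1),
    x 7 * y 7 + (x 4 * y 1 + x 5 * y 2 + x 6 * y 3)]

/-- The simple algebraic group of type `G₂` over `k` (algebraically closed, of characteristic
zero): the group of automorphisms of the octonion algebra over `k`. -/
def groupG2 (k : Type*) [Field k] : Subgroup (GL (Fin 8) k) where
  carrier := {g | ∀ x y : Fin 8 → k, (g : Matrix (Fin 8) (Fin 8) k) *ᵥ octMul x y =
    octMul ((g : Matrix (Fin 8) (Fin 8) k) *ᵥ x) ((g : Matrix (Fin 8) (Fin 8) k) *ᵥ y)}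
  one_mem' x y := by simp
  mul_mem' {g h} hg hh x y := by
    simp only [Units.val_mul, ← Matrix.mulVec_mulVec]
    rw [hh, hg]
  inv_mem' {g} hg x y := by
    have h : ((g⁻¹ : GL (Fin 8) k) : Matrix (Fin 8) (Fin 8) k) *
      (g : Matrix (Fin 8) (Fin 8) k) = 1 := g.inv_mul
    have h' : (g : Matrix (Fin 8) (Fin 8) k) *
      ((g⁻¹ : GL (Fin 8) k) : Matrix (Fin 8) (Fin 8) k) = 1 := g.mul_inv
    have := hg (((g⁻¹ : GL (Fin 8) k) : Matrix (Fin 8) (Fin 8) k) *ᵥ x)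
      (((g⁻¹ : GL (Fin 8) k) : Matrix (Fin 8) (Fin 8) k) *ᵥ y)
    rw [Matrix.mulVec_mulVec, Matrix.mulVec_mulVec, h', Matrix.one_mulVec,
      Matrix.one_mulVec] at this
    rw [← this, Matrix.mulVec_mulVec, h, Matrix.one_mulVec]

/-- The seven-dimensional simple `G₂`-module: the octonions of trace zero. -/
def traceZero (k : Type*) [Field k] : Submodule k (Fin 8 → k) where
  carrier := {x | x 0 + x 7 = 0}
  zero_mem' := by simp
  add_mem' {x y} hx hy := by
    simp only [Set.mem_ofPred_eq, Pi.add_apply] at *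
    linear_combination hx + hy
  smul_mem' c x hx := by
    simp only [Set.mem_ofPred_eq, Pi.smul_apply, smul_eq_mul] at *
    linear_combination c * hx

/-- The bracket relations of the semi-direct product `sl₂ ⋉ (n(1) ⊕ n(2) ⊕ n(3))`, where
`e, h, f` is a standard basis of `sl₂`, `n(1)` and `n(3)` are standard `sl₂`-modules with bases
`a₁, b₁` and `a₂, b₂`, and `n(2)` is the trivial `sl₂`-module spanned by `u`. -/
structure SemidirectRelations {L : Type*} [LieRing L] [LieAlgebra k L]
    (e h f a₁ b₁ u a₂ b₂ : L) : Prop where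
  e_f : ⁅e, f⁆ = h
  h_e : ⁅h, e⁆ = (2 : k) • e
  h_f : ⁅h, f⁆ = (-2 : k) • f
  e_a₁ : ⁅e, a₁⁆ = 0
  e_b₁ : ⁅e, b₁⁆ = a₁
  h_a₁ : ⁅h, a₁⁆ = a₁
  h_b₁ : ⁅h, b₁⁆ = -b₁
  f_a₁ : ⁅f, a₁⁆ = b₁
  f_b₁ : ⁅f, b₁⁆ = 0
  e_u : ⁅e, u⁆ = 0
  h_u : ⁅h, u⁆ = 0
  f_u : ⁅f, u⁆ = 0
  e_a₂ : ⁅e, a₂⁆ = 0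
  e_b₂ : ⁅e, b₂⁆ = a₂
  h_a₂ : ⁅h, a₂⁆ = a₂
  h_b₂ : ⁅h, b₂⁆ = -b₂
  f_a₂ : ⁅f, a₂⁆ = b₂
  f_b₂ : ⁅f, b₂⁆ = 0
  a₁_b₁ : ⁅a₁, b₁⁆ = u
  a₁_u : ⁅a₁, u⁆ = a₂
  b₁_u : ⁅b₁, u⁆ = b₂
  a₁_a₂ : ⁅a₁, a₂⁆ = 0
  a₁_b₂ : ⁅a₁, b₂⁆ = 0
  b₁_a₂ : ⁅b₁, a₂⁆ = 0
  b₁_b₂ : ⁅b₁, b₂⁆ = 0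
  u_a₂ : ⁅u, a₂⁆ = 0
  u_b₂ : ⁅u, b₂⁆ = 0
  a₂_b₂ : ⁅a₂, b₂⁆ = 0

/-- The quadratic element `2 a₁ b₂ - 2 b₁ a₂ + u²` of the symmetric algebra. -/
def quadraticInvariant {L : Type*} [AddCommGroup L] [Module k L] (a₁ b₁ u a₂ b₂ : L) :
    SymmetricAlgebra k L :=
  let s := SymmetricAlgebra.ι k L
  2 * (s a₁ * s b₂) - 2 * (s b₁ * s a₂) + s u ^ 2

/-- The cubic element `b₂² e + a₂ b₂ h - a₂² f + u (a₁ b₂ - a₂ b₁) + (1/3) u³` of the symmetric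
algebra. -/
def cubicInvariant {L : Type*} [AddCommGroup L] [Module k L] (e h f a₁ b₁ u a₂ b₂ : L) :
    SymmetricAlgebra k L :=
  let s := SymmetricAlgebra.ι k L
  s b₂ ^ 2 * s e + s a₂ * s b₂ * s h - s a₂ ^ 2 * s f + s u * (s a₁ * s b₂ - s a₂ * s b₁)
    + (1 / 3 : k) • s u ^ 3

end G2

end G2Case

end

/-! Everything is read off from a slice. Write a form `ξ ∈ 𝔮*` in the coordinates `x j = ξ (B j)`,
for `B = (e, h, f, a₁, b₁, u, a₂, b₂)`. If `ξ` does not vanish on `⟨a₂, b₂⟩`, that is, if `(x 6, x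
7) ≠ 0`, then the unipotent one-parameter groups of `e, f, b₁, u, a₂, b₂` move it to a point `(s, 0,
0, r, 0, 0, 0, 1)`, on which the two invariants take the values `2r` and `s`
(`exists_frameReach_slice`). So on this open set the orbits are exactly the fibres of the pair of
invariants.

Invariants: an invariant polynomial is determined by its restriction to the slice, where the
quadratic and the cubic element become the two coordinates. This gives generation
(`eq_aeval_of_invariant`) and algebraic independence.

Codimension: every orbit lies in a fibre of the invariants, and these have dimension at most 6
(`ringKrullDim_le_six`). An orbit with `(x 6, x 7) ≠ 0` has dimension at least 6, since its section
by `x 7 = 1` is an affine 5-space (`six_le_zariskiDim`). Hence non-regular forms lie in the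
codimension-2 subspace `x 6 = x 7 = 0`.

These arguments need only a basis with the stated brackets such that `Q` is generated by the
exponentials of its nilpotent members (`IsFrame`). For the standard vector such a basis is found by
solving the linear equations for derivations that kill it, and generation follows by moving
octonions explicitly (`stdGroup_le_stdGens`).

A general highest weight vector is conjugate to a multiple of the standard one
(`IsHighestWeightVector.octReach`). Up to scalars and conjugation a non-zero traceless octonion is
either the standard vector or `diag (1, -1)`. In the second case the Borel subalgebra would be
conjugate into the `sl₃` of derivations killing the diagonal. Lie's theorem then gives a short root
vector normalized by it, which maximality puts into the Borel subalgebra although it does not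
preserve the line of `diag (1, -1)`. -/

noncomputable section

namespace G2Case

/-! ### Exponentials of matrices of cube zero, and tangent vectors of groups -/

section NilpotentExponential

set_option linter.unusedSectionVars false

variable {n : Type*} [Fintype n] [DecidableEq n] {k : Type*} [Field k]

/-- The exponential of `t • X` for a matrix `X` with `X ^ 3 = 0`. -/
def nilExp (X : Matrix n n k) (t : k) : Matrix n n k :=
  1 + t • X + (t ^ 2 / 2) • (X * X)

lemma nilExp_mul_nilExp_neg [CharZero k] {X : Matrix n n k} (hX : X * X * X = 0) (t : k) :
    nilExp X t * nilExp X (-t) = 1 := by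
  have h4 : X * X * (X * X) = 0 := by rw [← mul_assoc, hX, zero_mul]
  have h3 : X * (X * X) = 0 := by rw [← mul_assoc, hX]
  simp only [nilExp, add_mul, mul_add, one_mul, mul_one, smul_mul_assoc, mul_smul_comm, h3, h4, hX,
    smul_zero, add_zero]
  module

/-- The exponential of `t • X` as an invertible matrix, for `X ^ 3 = 0`. -/
def nilExpUnit [CharZero k] (X : Matrix n n k) (hX : X * X * X = 0) (t : k) : GL n k where
  val := nilExp X t
  inv := nilExp X (-t)
  val_inv := nilExp_mul_nilExp_neg hX t
  inv_val := by simpa using nilExp_mul_nilExp_neg hX (-t)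

@[simp]
lemma coe_nilExpUnit [CharZero k] (X : Matrix n n k) (hX : X * X * X = 0) (t : k) :
    (nilExpUnit X hX t : Matrix n n k) = nilExp X t := rfl

lemma coe_nilExpUnit_inv [CharZero k] (X : Matrix n n k) (hX : X * X * X = 0) (t : k) :
    ((nilExpUnit X hX t)⁻¹ : GL n k) = nilExpUnit X hX (-t) := by
  refine inv_eq_of_mul_eq_one_right (Units.ext ?_)
  exact nilExp_mul_nilExp_neg hX t

lemma nilExp_mulVec (X : Matrix n n k) (t : k) (x : n → k) :
    nilExp X t *ᵥ x = x + t • X *ᵥ x + (t ^ 2 / 2) • X *ᵥ (X *ᵥ x) := by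
  simp [nilExp, Matrix.add_mulVec, Matrix.smul_mulVec, Matrix.mulVec_mulVec]

lemma nilExp_mulVec_apply (X : Matrix n n k) (t : k) (x : n → k) (i : n) :
    (nilExp X t *ᵥ x) i = x i + t * (X *ᵥ x) i + t ^ 2 / 2 * (X *ᵥ (X *ᵥ x)) i := by
  simp [nilExp_mulVec]

lemma dirDeriv_zero (M X : Matrix n n k) : dirDeriv M X 0 = 0 := by
  simp [dirDeriv]

lemma dirDeriv_sub (M X : Matrix n n k) (f f' : MvPolynomial (n × n) k) :
    dirDeriv M X (f - f') = dirDeriv M X f - dirDeriv M X f' := by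
  rw [eq_sub_iff_add_eq, ← dirDeriv_add, sub_add_cancel]

lemma dirDeriv_sum {ι : Type*} (M X : Matrix n n k) (s : Finset ι)
    (f : ι → MvPolynomial (n × n) k) :
    dirDeriv M X (∑ i ∈ s, f i) = ∑ i ∈ s, dirDeriv M X (f i) := by
  classical
  induction s using Finset.induction_on with
  | empty => simp [dirDeriv_zero]
  | insert a s ha ih => rw [Finset.sum_insert ha, Finset.sum_insert ha, dirDeriv_add, ih]

/-- The term `t ^ 2 • Y` does not affect the first-order part at `t = 0`, so it can serve as the
quadratic term of an exponential. -/
lemma exists_curve_polynomial (X Y : Matrix n n k) (f : MvPolynomial (n × n) k) :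
    ∃ p : Polynomial k, (∀ t, p.eval t = evalAt (1 + t • X + t ^ 2 • Y) f) ∧
      p.derivative.eval 0 = dirDeriv 1 X f := by
  induction f using MvPolynomial.induction_on with
  | C a => exact ⟨Polynomial.C a, by simp [evalAt], by simp [dirDeriv_C]⟩
  | add p q hp hq =>
    obtain ⟨P, hP, hP'⟩ := hp
    obtain ⟨R, hR, hR'⟩ := hq
    exact ⟨P + R, fun t => by simp [hP, hR], by simp [hP', hR', dirDeriv_add]⟩
  | mul_X p q hp =>
    obtain ⟨P, hP, hP'⟩ := hp
    refine ⟨P * (Polynomial.C ((1 : Matrix n n k) q.1 q.2) + Polynomial.C (X q.1 q.2) * Polynomial.X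
      + Polynomial.C (Y q.1 q.2) * Polynomial.X ^ 2), fun t => ?_, ?_⟩
    · simp only [Polynomial.eval_mul, hP, map_mul, Polynomial.eval_add, Polynomial.eval_C,
        Polynomial.eval_X, Polynomial.eval_pow]
      simp [evalAt, mul_comm]
    · have h0 := hP 0
      simp only [zero_smul, add_zero, ne_eq, OfNat.ofNat_ne_zero, not_false_eq_true, zero_pow]
        at h0
      rw [dirDeriv_mul, dirDeriv_X, ← hP', ← h0]
      simp [evalAt]
      ring

/-- A polynomial vanishing on `Q`, pulled back along `t ↦ exp (t X)`, vanishes at every point of an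
infinite field. It is therefore zero, and so is its derivative at `0`. -/
lemma mem_lieAlg_of_nilExpUnit_mem [CharZero k] {Q : Subgroup (GL n k)} {X : Matrix n n k}
    (hX : X * X * X = 0) (h : ∀ t, nilExpUnit X hX t ∈ Q) : X ∈ lieAlg Q := by
  intro f hf
  obtain ⟨p, hp, hp'⟩ := exists_curve_polynomial X ((1 / 2 : k) • (X * X)) f
  have : p = 0 := by
    refine Polynomial.funext fun t => ?_
    rw [hp, Polynomial.eval_zero, ← hf _ (h t), coe_nilExpUnit, nilExp, smul_smul]
    congr 4
    ring
  rw [← hp', this]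
  simp

/-- The `i`-th coordinate of `M *ᵥ x` as a polynomial in the entries of `M`. -/
def rowForm (x : n → k) (i : n) : MvPolynomial (n × n) k :=
  ∑ j, MvPolynomial.C (x j) * MvPolynomial.X (i, j)

@[simp]
lemma evalAt_rowForm (M : Matrix n n k) (x : n → k) (i : n) :
    evalAt M (rowForm x i) = (M *ᵥ x) i := by
  simp [rowForm, evalAt, Matrix.mulVec, dotProduct, mul_comm]

@[simp]
lemma dirDeriv_rowForm (M X : Matrix n n k) (x : n → k) (i : n) :
    dirDeriv M X (rowForm x i) = (X *ᵥ x) i := by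
  rw [rowForm, dirDeriv_sum]
  simp [dirDeriv_mul, dirDeriv_C, dirDeriv_X, evalAt, Matrix.mulVec, dotProduct, mul_comm]

/-- The coordinates of `g v - v` are polynomials in the entries of `g` that vanish on `Q`;
differentiate them at `1`. -/
lemma mulVec_eq_zero_of_mem_lieAlg {Q : Subgroup (GL n k)} {v : n → k}
    (hv : ∀ g ∈ Q, (g : Matrix n n k) *ᵥ v = v) {X : Matrix n n k} (hX : X ∈ lieAlg Q) :
    X *ᵥ v = 0 := by
  funext i
  have := hX (rowForm v i - MvPolynomial.C (v i)) fun g hg => by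
    rw [map_sub, evalAt_rowForm, hv g hg, sub_eq_zero]
    simp [evalAt]
  simpa [dirDeriv_sub, dirDeriv_C] using this

end NilpotentExponential

/-! ### Derivations of the octonions and automorphisms -/

section Derivations

variable {k : Type*} [Field k]

lemma octMul_add_left (x x' y : Fin 8 → k) :
    octMul (x + x') y = octMul x y + octMul x' y := by
  funext i; fin_cases i <;> simp [octMul] <;> ring

lemma octMul_add_right (x y y' : Fin 8 → k) :
    octMul x (y + y') = octMul x y + octMul x y' := by
  funext i; fin_cases i <;> simp [octMul] <;> ring

lemma octMul_smul_left (c : k) (x y : Fin 8 → k) : octMul (c • x) y = c • octMul x y := by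
  funext i; fin_cases i <;> simp [octMul] <;> ring

lemma octMul_smul_right (c : k) (x y : Fin 8 → k) : octMul x (c • y) = c • octMul x y := by
  funext i; fin_cases i <;> simp [octMul] <;> ring

/-- A matrix acting on the octonions as a derivation. -/
def IsDer (X : Matrix (Fin 8) (Fin 8) k) : Prop :=
  ∀ x y, X *ᵥ octMul x y = octMul (X *ᵥ x) y + octMul x (X *ᵥ y)

lemma nilExpUnit_mem_groupG2 [CharZero k] {X : Matrix (Fin 8) (Fin 8) k} (h : IsDer X)
    (hX : X * X * X = 0) (t : k) : nilExpUnit X hX t ∈ groupG2 k := by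
  have h3 : ∀ x, X *ᵥ (X *ᵥ (X *ᵥ x)) = 0 := fun x => by
    rw [Matrix.mulVec_mulVec, Matrix.mulVec_mulVec, hX, Matrix.zero_mulVec]
  have hd : ∀ x y, X *ᵥ octMul x y = octMul (X *ᵥ x) y + octMul x (X *ᵥ y) := h
  intro x y
  have d3 := h3 (octMul x y)
  have d4 : X *ᵥ (X *ᵥ (X *ᵥ (X *ᵥ octMul x y))) = 0 := by rw [d3, Matrix.mulVec_zero]
  have oz : ∀ z : Fin 8 → k, octMul z 0 = 0 := fun z => by
    simpa using octMul_smul_right 0 z 0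
  have zo : ∀ z : Fin 8 → k, octMul 0 z = 0 := fun z => by
    simpa using octMul_smul_left 0 0 z
  simp only [hd, Matrix.mulVec_add, h3, oz, zo, zero_add, add_zero]
    at d3 d4
  simp only [coe_nilExpUnit, nilExp_mulVec, hd, Matrix.mulVec_add, octMul_add_left,
    octMul_add_right, octMul_smul_left, octMul_smul_right]
  funext i
  have d3' := congrFun d3 i
  have d4' := congrFun d4 i
  simp only [Pi.add_apply, Pi.zero_apply, Pi.smul_apply, smul_eq_mul] at d3' d4' ⊢
  -- The product of the two truncated exponentials exceeds the exponential of the product by terms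
  -- in `t ^ 3` and `t ^ 4`. By the Leibniz rule these are `X³(xy) / 6` and `X⁴(xy) / 24`, both
  -- zero.
  linear_combination (-t ^ 3 / 6) * d3' - (t ^ 4 / 24) * d4'

/-- Differentiate at `1` the equations `g (x y) = (g x) (g y)`, which are polynomial in the entries
of `g`. -/
lemma isDer_of_mem_lieAlg {Q : Subgroup (GL (Fin 8) k)} (hQ : Q ≤ groupG2 k)
    {X : Matrix (Fin 8) (Fin 8) k} (hX : X ∈ lieAlg Q) : IsDer X := by
  intro x y
  let a := rowForm (n := Fin 8) x
  let b := rowForm (n := Fin 8) y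
  -- The coordinates of `(M x) (M y)` as polynomials in `M`: the formula of `octMul` with the linear
  -- forms `a`, `b` as entries.
  let c : Fin 8 → MvPolynomial (Fin 8 × Fin 8) k :=
    ![a 0 * b 0 + (a 1 * b 4 + a 2 * b 5 + a 3 * b 6),
      a 0 * b 1 + b 7 * a 1 - (a 5 * b 6 - a 6 * b 5),
      a 0 * b 2 + b 7 * a 2 - (a 6 * b 4 - a 4 * b 6),
      a 0 * b 3 + b 7 * a 3 - (a 4 * b 5 - a 5 * b 4),
      b 0 * a 4 + a 7 * b 4 + (a 2 * b 3 - a 3 * b 2),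
      b 0 * a 5 + a 7 * b 5 + (a 3 * b 1 - a 1 * b 3),
      b 0 * a 6 + a 7 * b 6 + (a 1 * b 2 - a 2 * b 1),
      a 7 * b 7 + (a 4 * b 1 + a 5 * b 2 + a 6 * b 3)]
  have hc : ∀ M : Matrix (Fin 8) (Fin 8) k, ∀ i,
      evalAt M (c i) = octMul (M *ᵥ x) (M *ᵥ y) i := by
    intro M i
    fin_cases i <;> simp [c, a, b, octMul]
  have hd : ∀ i, dirDeriv 1 X (c i) = (octMul (X *ᵥ x) y + octMul x (X *ᵥ y)) i := by
    intro i
    fin_cases i <;>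
      simp [c, a, b, octMul, dirDeriv_add, dirDeriv_mul, dirDeriv_sub] <;> ring
  funext i
  have := hX (rowForm (octMul x y) i - c i) fun g hg => by
    rw [map_sub, evalAt_rowForm, hc, hQ hg, sub_self]
  rw [dirDeriv_sub, dirDeriv_rowForm, hd, sub_eq_zero] at this
  exact this

end Derivations

/-! ### The coadjoint action in coordinates and the slice -/

section Points

variable {k : Type*} [Field k]

/-- The coadjoint action of the one-parameter group of the basis element with index `i` in the
coordinates given by the basis `e, h, f, a₁, b₁, u, a₂, b₂`. -/
def frameAct (i : Fin 8) (t : k) (x : Fin 8 → k) : Fin 8 → k :=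
  ![![x 0, x 1 - 2 * t * x 0, x 2 + t * x 1 - t ^ 2 * x 0, x 3, x 4 + t * x 3, x 5, x 6,
      x 7 + t * x 6],
    x,
    ![x 0 - t * x 1 - t ^ 2 * x 2, x 1 + 2 * t * x 2, x 2, x 3 + t * x 4, x 4, x 5,
      x 6 + t * x 7, x 7],
    ![x 0, x 1 - t * x 3, x 2 - t * x 4 - t ^ 2 / 2 * x 5 - t ^ 3 / 6 * x 6, x 3,
      x 4 + t * x 5 + t ^ 2 / 2 * x 6, x 5 + t * x 6, x 6, x 7],
    ![x 0 - t * x 3 + t ^ 2 / 2 * x 5 + t ^ 3 / 6 * x 7, x 1 + t * x 4, x 2,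
      x 3 - t * x 5 - t ^ 2 / 2 * x 7, x 4, x 5 + t * x 7, x 6, x 7],
    ![x 0, x 1, x 2, x 3 - t * x 6, x 4 - t * x 7, x 5, x 6, x 7],
    ![x 0, x 1 - t * x 6, x 2 - t * x 7, x 3, x 4, x 5, x 6, x 7],
    ![x 0 - t * x 6, x 1 + t * x 7, x 2, x 3, x 4, x 5, x 6, x 7]] i

/-- The values of the quadratic invariant. -/
def quadVal (x : Fin 8 → k) : k := 2 * (x 3 * x 7) - 2 * (x 4 * x 6) + x 5 ^ 2

/-- The values of the cubic invariant. -/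
def cubVal (x : Fin 8 → k) : k :=
  x 7 ^ 2 * x 0 + x 6 * x 7 * x 1 - x 6 ^ 2 * x 2 + x 5 * (x 3 * x 7 - x 6 * x 4) + 1 / 3 * x 5 ^ 3

lemma quadVal_frameAct [CharZero k] (i : Fin 8) (t : k) (x : Fin 8 → k) :
    quadVal (frameAct i t x) = quadVal x := by
  fin_cases i <;> simp only [frameAct, quadVal, Fin.zero_eta, Fin.mk_one, Fin.reduceFinMk,
    Matrix.cons_val] <;> ring

lemma cubVal_frameAct [CharZero k] (i : Fin 8) (t : k) (x : Fin 8 → k) :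
    cubVal (frameAct i t x) = cubVal x := by
  fin_cases i <;> simp only [frameAct, cubVal, Fin.zero_eta, Fin.mk_one, Fin.reduceFinMk,
    Matrix.cons_val] <;> ring

/-- The coordinates 6 and 7 are the restriction of the form to the ideal `⟨a₂, b₂⟩`, so whether they
both vanish is an invariant property. -/
lemma frameAct_six_seven_ne_zero_iff (i : Fin 8) (t : k) (x : Fin 8 → k) :
    frameAct i t x 6 ≠ 0 ∨ frameAct i t x 7 ≠ 0 ↔ x 6 ≠ 0 ∨ x 7 ≠ 0 := by
  rw [← not_iff_not]
  simp only [not_or, not_not]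
  fin_cases i <;> constructor <;> rintro ⟨h6, h7⟩ <;> simp_all [frameAct]

/-- One point is obtained from another by successive one-parameter groups. -/
def FrameReach (x y : Fin 8 → k) : Prop :=
  Relation.ReflTransGen (fun x y => ∃ i t, i ≠ 1 ∧ y = frameAct i t x) x y

lemma FrameReach.single {i : Fin 8} (hi : i ≠ 1) (t : k) (x : Fin 8 → k) :
    FrameReach x (frameAct i t x) :=
  Relation.ReflTransGen.single ⟨i, t, hi, rfl⟩

lemma FrameReach.trans {x y z : Fin 8 → k} (h : FrameReach x y) (h' : FrameReach y z) :
    FrameReach x z :=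
  Relation.ReflTransGen.trans h h'

lemma FrameReach.apply_eq {α : Type*} {F : (Fin 8 → k) → α}
    (hF : ∀ i t x, i ≠ 1 → F (frameAct i t x) = F x) {x y : Fin 8 → k} (h : FrameReach x y) :
    F y = F x := by
  induction h with
  | refl => rfl
  | tail _ h ih =>
    obtain ⟨i, t, hi, rfl⟩ := h
    rw [hF i t _ hi, ih]

/-- The `sl₂` part normalizes `(x 6, x 7)` to `(0, 1)`. After that `b₁, u, b₂, a₂` translate the
coordinates 5, 4, 1, 2 by multiples of `x 7 = 1`, so these can be killed in this order without
disturbing the earlier ones. The remaining coordinates 0 and 3 are dictated by the values of the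
invariants. -/
lemma exists_frameReach_slice [CharZero k] (x : Fin 8 → k) (hx : x 6 ≠ 0 ∨ x 7 ≠ 0) :
    FrameReach x ![cubVal x, 0, 0, 1 / 2 * quadVal x, 0, 0, 0, 1] := by
  obtain ⟨y, hy, hy6⟩ : ∃ y, FrameReach x y ∧ y 6 ≠ 0 := by
    by_cases h : x 6 = 0
    · refine ⟨_, .single (i := 2) (by decide) 1 x, ?_⟩
      simpa [frameAct, h] using hx
    · exact ⟨x, .refl, h⟩
  obtain ⟨z, hz, hz7⟩ : ∃ z, FrameReach x z ∧ z 7 = 1 := by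
    refine ⟨_, hy.trans (.single (i := 0) (by decide) ((1 - y 7) / y 6) y), ?_⟩
    simp [frameAct, hy6]
  obtain ⟨z, hz, hz7, hz6⟩ : ∃ z, FrameReach x z ∧ z 7 = 1 ∧ z 6 = 0 :=
    ⟨_, hz.trans (.single (i := 2) (by decide) (-z 6) z), by simp [frameAct, hz7]⟩
  obtain ⟨z, hz, hz7, hz6, hz5⟩ : ∃ z, FrameReach x z ∧ z 7 = 1 ∧ z 6 = 0 ∧ z 5 = 0 :=
    ⟨_, hz.trans (.single (i := 4) (by decide) (-z 5) z), by simp [frameAct, hz7, hz6]⟩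
  obtain ⟨z, hz, hz7, hz6, hz5, hz4⟩ :
      ∃ z, FrameReach x z ∧ z 7 = 1 ∧ z 6 = 0 ∧ z 5 = 0 ∧ z 4 = 0 :=
    ⟨_, hz.trans (.single (i := 5) (by decide) (z 4) z), by simp [frameAct, hz7, hz6, hz5]⟩
  obtain ⟨z, hz, hz7, hz6, hz5, hz4, hz1⟩ :
      ∃ z, FrameReach x z ∧ z 7 = 1 ∧ z 6 = 0 ∧ z 5 = 0 ∧ z 4 = 0 ∧ z 1 = 0 :=
    ⟨_, hz.trans (.single (i := 7) (by decide) (-z 1) z), by simp [frameAct, hz7, hz6, hz5, hz4]⟩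
  obtain ⟨z, hz, hz7, hz6, hz5, hz4, hz1, hz2⟩ :
      ∃ z, FrameReach x z ∧ z 7 = 1 ∧ z 6 = 0 ∧ z 5 = 0 ∧ z 4 = 0 ∧ z 1 = 0 ∧ z 2 = 0 :=
    ⟨_, hz.trans (.single (i := 6) (by decide) (z 2) z),
      by simp [frameAct, hz7, hz6, hz5, hz4, hz1]⟩
  have h1 := hz.apply_eq (F := quadVal) fun i t x _ => quadVal_frameAct i t x
  have h2 := hz.apply_eq (F := cubVal) fun i t x _ => cubVal_frameAct i t x
  convert hz using 1
  rw [← h1, ← h2]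
  funext i
  fin_cases i <;> simp [quadVal, cubVal, *]

end Points

/-! ### Invariant polynomials and their restriction to the slice -/

section Polynomials

open MvPolynomial

variable {k : Type*} [Field k]

/-- The quadratic invariant as a polynomial in the coordinates. -/
def quadPoly (k : Type*) [Field k] : MvPolynomial (Fin 8) k :=
  2 * (X 3 * X 7) - 2 * (X 4 * X 6) + X 5 ^ 2

/-- The cubic invariant as a polynomial in the coordinates. -/
def cubPoly (k : Type*) [Field k] : MvPolynomial (Fin 8) k :=
  X 7 ^ 2 * X 0 + X 6 * X 7 * X 1 - X 6 ^ 2 * X 2 + X 5 * (X 3 * X 7 - X 6 * X 4)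
    + C (1 / 3) * X 5 ^ 3

lemma eval_quadPoly (x : Fin 8 → k) : eval x (quadPoly k) = quadVal x := by
  simp [quadPoly, quadVal]

lemma eval_cubPoly (x : Fin 8 → k) : eval x (cubPoly k) = cubVal x := by
  simp [cubPoly, cubVal]

/-- Restriction of polynomials to the slice on which the two invariants are coordinates. -/
def restrictSlice (k : Type*) [Field k] : MvPolynomial (Fin 8) k →ₐ[k] MvPolynomial (Fin 2) k :=
  aeval ![X 1, 0, 0, C (1 / 2) * X 0, 0, 0, 0, 1]

lemma eval_restrictSlice (F : MvPolynomial (Fin 8) k) (c : Fin 2 → k) :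
    eval c (restrictSlice k F) = eval ![c 1, 0, 0, 1 / 2 * c 0, 0, 0, 0, 1] F := by
  have : (aeval c : MvPolynomial (Fin 2) k →ₐ[k] k).comp (restrictSlice k) =
      aeval ![c 1, 0, 0, 1 / 2 * c 0, 0, 0, 0, 1] := by
    refine algHom_ext fun i => ?_
    fin_cases i <;> simp [restrictSlice]
  exact congrArg (fun φ => φ F) this

lemma restrictSlice_quadPoly [CharZero k] : restrictSlice k (quadPoly k) = X 0 := by
  have : (2 : MvPolynomial (Fin 2) k) * C (1 / 2) = 1 := by
    rw [show (2 : MvPolynomial (Fin 2) k) = C 2 from rfl, ← C_mul]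
    simp
  simp only [restrictSlice, quadPoly, map_add, map_sub, map_mul, map_pow, map_ofNat, aeval_X,
    Matrix.cons_val]
  linear_combination X 0 * this

lemma restrictSlice_cubPoly : restrictSlice k (cubPoly k) = X 1 := by
  simp [restrictSlice, cubPoly]

/-- Both sides agree wherever the slice can be reached, in particular where `x 6 ≠ 0`. Multiplying
by `X 6` makes this an identity at all points, and `X 6` cancels in a domain. -/
lemma eq_aeval_of_invariant [CharZero k] {F : MvPolynomial (Fin 8) k}
    (hF : ∀ i t x, i ≠ 1 → eval (frameAct i t x) F = eval x F) :
    F = aeval ![quadPoly k, cubPoly k] (restrictSlice k F) := by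
  have h : (X 6 : MvPolynomial (Fin 8) k) *
      (F - aeval ![quadPoly k, cubPoly k] (restrictSlice k F)) = 0 := by
    refine funext fun x => ?_
    rw [map_mul, eval_X, map_zero, map_sub]
    by_cases hx : x 6 = 0
    · rw [hx, zero_mul]
    · have h1 := (exists_frameReach_slice x (.inl hx)).apply_eq
        (F := fun x => eval x F) hF
      have h2 : eval x (aeval ![quadPoly k, cubPoly k] (restrictSlice k F)) =
          eval ![quadVal x, cubVal x] (restrictSlice k F) := by
        have : (aeval x : MvPolynomial (Fin 8) k →ₐ[k] k).comp (aeval ![quadPoly k, cubPoly k]) =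
            aeval ![quadVal x, cubVal x] := by
          refine algHom_ext fun i => ?_
          fin_cases i
          · simpa using eval_quadPoly x
          · simpa using eval_cubPoly x
        exact congrArg (fun φ => φ (restrictSlice k F)) this
      rw [h2, eval_restrictSlice]
      simp only [Matrix.cons_val_zero, Matrix.cons_val_one]
      rw [h1, sub_self, mul_zero]
  exact sub_eq_zero.1 ((mul_eq_zero.1 h).resolve_left (X_ne_zero 6))

/-- Along a polynomial curve `F` is a polynomial in `t`; multiplied by `t - t₀` it vanishes
everywhere, hence it is zero. -/
lemma eval_eq_zero_of_polynomial_curve {F : MvPolynomial (Fin 8) k} [CharZero k]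
    (P : Fin 8 → Polynomial k) (t₀ : k)
    (h : ∀ t, t ≠ t₀ → eval (fun j => (P j).eval t) F = 0) (t : k) :
    eval (fun j => (P j).eval t) F = 0 := by
  have hp : ∀ t, (aeval P F).eval t = eval (fun j => (P j).eval t) F := fun t => by
    have : (Polynomial.aeval t : Polynomial k →ₐ[k] k).comp (aeval P) =
        aeval fun j => (P j).eval t := by
      refine algHom_ext fun j => ?_
      simp
    exact congrArg (fun φ => φ F) this
  have hz : (Polynomial.X - Polynomial.C t₀) * aeval P F = 0 := by
    refine Polynomial.funext fun t => ?_
    by_cases ht : t = t₀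
    · simp [ht]
    · simp only [Polynomial.eval_mul, hp, h t ht, mul_zero, Polynomial.eval_zero]
  rw [← hp, (mul_eq_zero.1 hz).resolve_left (Polynomial.X_sub_C_ne_zero t₀), Polynomial.eval_zero]

lemma eval_eq_zero_of_eval_frameAct_e {F : MvPolynomial (Fin 8) k} [CharZero k] (t₀ : k)
    (x : Fin 8 → k) (h : ∀ t, t ≠ t₀ → eval (frameAct 0 t x) F = 0) : eval x F = 0 := by
  have key : ∀ t, frameAct 0 t x = fun j => Polynomial.eval t
      ((![.C (x 0), .C (x 1) - 2 * .X * .C (x 0), .C (x 2) + .X * .C (x 1) - .X ^ 2 * .C (x 0),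
        .C (x 3), .C (x 4) + .X * .C (x 3), .C (x 5), .C (x 6), .C (x 7) + .X * .C (x 6)] :
        Fin 8 → Polynomial k) j) := by
    intro t
    funext j
    fin_cases j <;> simp [frameAct] <;> ring
  simp only [key] at h
  have := eval_eq_zero_of_polynomial_curve _ t₀ h 0
  rw [← key] at this
  convert this
  funext j
  fin_cases j <;> simp [frameAct]

lemma eval_eq_zero_of_eval_frameAct_f {F : MvPolynomial (Fin 8) k} [CharZero k] (t₀ : k)
    (x : Fin 8 → k) (h : ∀ t, t ≠ t₀ → eval (frameAct 2 t x) F = 0) : eval x F = 0 := by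
  have key : ∀ t, frameAct 2 t x = fun j => Polynomial.eval t
      ((![.C (x 0) - .X * .C (x 1) - .X ^ 2 * .C (x 2), .C (x 1) + 2 * .X * .C (x 2), .C (x 2),
        .C (x 3) + .X * .C (x 4), .C (x 4), .C (x 5), .C (x 6) + .X * .C (x 7), .C (x 7)] :
        Fin 8 → Polynomial k) j) := by
    intro t
    funext j
    fin_cases j <;> simp [frameAct] <;> ring
  simp only [key] at h
  have := eval_eq_zero_of_polynomial_curve _ t₀ h 0
  rw [← key] at this
  convert this
  funext j
  fin_cases j <;> simp [frameAct]

/-- A polynomial `F` for which `(x₇ - 1) F` vanishes on a set stable under the one-parameter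
groups and avoiding `x₆ = x₇ = 0` vanishes on this set. -/
lemma eval_eq_zero_of_mul_sub_one [CharZero k] {Z : Set (Fin 8 → k)}
    (hZ : ∀ i t x, i ≠ 1 → x ∈ Z → frameAct i t x ∈ Z) (hZ' : ∀ x ∈ Z, x 6 ≠ 0 ∨ x 7 ≠ 0)
    {F : MvPolynomial (Fin 8) k} (hF : ∀ x ∈ Z, (x 7 - 1) * eval x F = 0) {x : Fin 8 → k}
    (hx : x ∈ Z) : eval x F = 0 := by
  have h6 : ∀ y ∈ Z, y 6 ≠ 0 → eval y F = 0 := by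
    intro y hy hy6
    -- Along the orbit of `exp (t e)` the coordinate 7 is `y 7 + t * y 6`, which equals `1` for this
    -- one `t` only.
    refine eval_eq_zero_of_eval_frameAct_e ((1 - y 7) / y 6) y fun t ht => ?_
    refine (mul_eq_zero.1 (hF _ (hZ 0 t y (by decide) hy))).resolve_left fun h => ht ?_
    have h' : y 7 + t * y 6 - 1 = 0 := h
    field_simp
    linear_combination h'
  by_cases hx6 : x 6 = 0
  -- Here `x 7 ≠ 0`, and `exp (t f)` with `t ≠ 0` makes the coordinate 6 non-zero.
  · refine eval_eq_zero_of_eval_frameAct_f 0 x fun t ht => ?_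
    refine h6 _ (hZ 2 t x (by decide) hx) ?_
    have : frameAct 2 t x 6 = t * x 7 := by simp [frameAct, hx6]
    rw [this]
    exact mul_ne_zero ht ((hZ' x hx).resolve_left (not_not.2 hx6))
  · exact h6 x hx hx6

end Polynomials

/-! ### Upper bound for the dimension of fibres -/

section KrullDimension

/-- Incomparability: contraction of primes along an integral map is strictly monotone. Injectivity
plays no role. -/
lemma ringKrullDim_le_of_isIntegral (R A : Type*) [CommRing R] [CommRing A] [Algebra R A]
    [Algebra.IsIntegral R A] : ringKrullDim A ≤ ringKrullDim R := by
  refine Order.krullDim_le_of_strictMono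
    (fun p : PrimeSpectrum A => PrimeSpectrum.comap (algebraMap R A) p) fun p q h => ?_
  exact Ideal.IsIntegral.comap_lt_comap h

/-- Multiply the cubic relation by its conjugate under `u ↦ -u` and replace `u ^ 2` by its linear
expression in `b`. The correction has degree 3 in `b`, so the result is a monic sextic. -/
lemma isIntegral_of_sextic {R A : Type*} [CommRing R] [CommRing A] [Algebra R A] {b u : A}
    (p₀ p₁ p₂ m₀ m₁ l₀ l₁ : R)
    (hu : u ^ 2 = algebraMap R A m₁ * b + algebraMap R A m₀)
    (hb : b ^ 3 + algebraMap R A p₂ * b ^ 2 + algebraMap R A p₁ * b + algebraMap R A p₀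
      + u * (algebraMap R A l₁ * b + algebraMap R A l₀) = 0) : IsIntegral R b := by
  nontriviality R
  let q : Polynomial R := .C (2 * p₂) * .X ^ 5 + .C (p₂ ^ 2 + 2 * p₁) * .X ^ 4
    + .C (2 * p₀ + 2 * p₁ * p₂ - m₁ * l₁ ^ 2) * .X ^ 3
    + .C (p₁ ^ 2 + 2 * p₀ * p₂ - m₀ * l₁ ^ 2 - 2 * m₁ * l₁ * l₀) * .X ^ 2
    + .C (2 * p₀ * p₁ - m₁ * l₀ ^ 2 - 2 * m₀ * l₀ * l₁) * .X + .C (p₀ ^ 2 - m₀ * l₀ ^ 2)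
  have hq : q.degree ≤ 5 := by
    simp only [q]
    compute_degree
  refine ⟨.X ^ 6 + q, Polynomial.monic_X_pow_add (lt_of_le_of_lt hq (by norm_num)), ?_⟩
  simp only [q, Polynomial.eval₂_add, Polynomial.eval₂_mul, Polynomial.eval₂_pow,
    Polynomial.eval₂_X, Polynomial.eval₂_C]
  simp only [map_add, map_sub, map_mul, map_pow, map_ofNat]
  linear_combination (b ^ 3 + algebraMap R A p₂ * b ^ 2 + algebraMap R A p₁ * b
    + algebraMap R A p₀ - u * (algebraMap R A l₁ * b + algebraMap R A l₀)) * hb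
    + (algebraMap R A l₁ * b + algebraMap R A l₀) ^ 2 * hu

variable {k : Type*} [Field k]

lemma ringKrullDim_le_card_of_surjective {A : Type*} [CommRing A] [Algebra k A] {m : ℕ}
    (φ : MvPolynomial (Fin m) k →ₐ[k] A) (hφ : Function.Surjective φ) : ringKrullDim A ≤ m := by
  refine (ringKrullDim_le_of_surjective φ.toRingHom hφ).trans ?_
  rw [MvPolynomial.ringKrullDim_of_isNoetherianRing, ringKrullDim_eq_zero_of_field]
  simp

open MvPolynomial in
-- A Noether normalization: the two equations make `y 7` and `y 5` integral over six other elements.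
lemma ringKrullDim_le_six {A : Type*} [CommRing A] [Algebra k A] (y : Fin 8 → A)
    (hy : Algebra.adjoin k (Set.range y) = ⊤) (c₁ c₂ : k)
    (h₁ : 2 * (y 3 * y 7) - 2 * (y 4 * y 6) + y 5 ^ 2 = algebraMap k A c₁)
    (h₂ : y 7 ^ 2 * y 0 + y 6 * y 7 * y 1 - y 6 ^ 2 * y 2 + y 5 * (y 3 * y 7 - y 6 * y 4)
      + algebraMap k A (1 / 3) * y 5 ^ 3 = algebraMap k A c₂) : ringKrullDim A ≤ 6 := by
  -- The shift of `y 0` by `y 7` turns the term `y 7 ^ 2 * y 0` of the cubic into `y 7 ^ 3` plus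
  -- lower order terms, which makes it monic in `y 7`.
  let φ : MvPolynomial (Fin 6) k →ₐ[k] A := aeval ![y 0 - y 7, y 1, y 2, y 3, y 4, y 6]
  let _ : Algebra (MvPolynomial (Fin 6) k) A := φ.toRingHom.toAlgebra
  have hφ : ∀ p, algebraMap (MvPolynomial (Fin 6) k) A p = φ p := fun _ => rfl
  have hX : ∀ i, algebraMap (MvPolynomial (Fin 6) k) A (X i) =
      ![y 0 - y 7, y 1, y 2, y 3, y 4, y 6] i := fun i => by rw [hφ]; simp [φ]
  have hC : ∀ c, algebraMap (MvPolynomial (Fin 6) k) A (C c) = algebraMap k A c := fun c => by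
    rw [hφ]; simp [φ]
  have hint : ∀ i, IsIntegral (MvPolynomial (Fin 6) k)
      (![y 0 - y 7, y 1, y 2, y 3, y 4, y 6] i) := fun i => by
    rw [← hX]; exact isIntegral_algebraMap
  have h7 : IsIntegral (MvPolynomial (Fin 6) k) (y 7) := by
    -- The quadric expresses `y 5 ^ 2` linearly in `y 7`; inserting this in `y 5 ^ 3 / 3` leaves the
    -- cubic linear in `y 5`. Note that the variable `X 5` stands for `y 6`.
    refine isIntegral_of_sextic (u := y 5) (-(X 5 ^ 2 * X 2) - C c₂) (X 5 * X 1) (X 0)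
      (2 * (X 4 * X 5) + C c₁) (-2 * X 3)
      (C (1 / 3) * (2 * (X 4 * X 5) + C c₁) - X 5 * X 4) (X 3 + C (1 / 3) * (-2 * X 3)) ?_ ?_
    · simp only [map_add, map_mul, map_neg, map_ofNat, hX, hC, Matrix.cons_val]
      linear_combination h₁
    · simp only [map_add, map_sub, map_mul, map_neg, map_pow, map_ofNat, hX, hC, Matrix.cons_val]
      linear_combination h₂ - algebraMap k A (1 / 3) * y 5 * h₁
  have h5 : IsIntegral (MvPolynomial (Fin 6) k) (y 5) := by
    refine IsIntegral.of_pow (n := 2) (by norm_num) ?_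
    have : y 5 ^ 2 = algebraMap (MvPolynomial (Fin 6) k) A (2 * (X 4 * X 5) + C c₁) -
        algebraMap (MvPolynomial (Fin 6) k) A (2 * X 3) * y 7 := by
      simp only [map_add, map_mul, map_ofNat, hX, hC, Matrix.cons_val]
      linear_combination h₁
    rw [this]
    exact isIntegral_algebraMap.sub (isIntegral_algebraMap.mul h7)
  have hall : ∀ i, IsIntegral (MvPolynomial (Fin 6) k) (y i) := by
    intro i
    fin_cases i
    · simpa using (hint 0).add h7
    exacts [hint 1, hint 2, hint 3, hint 4, h5, hint 5, h7]
  have : Algebra.IsIntegral (MvPolynomial (Fin 6) k) A := by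
    refine ⟨fun a => ?_⟩
    have ha : a ∈ Algebra.adjoin k (Set.range y) := hy ▸ Algebra.mem_top
    induction ha using Algebra.adjoin_induction with
    | mem x hx => obtain ⟨i, rfl⟩ := hx; exact hall i
    | algebraMap c => rw [← hC]; exact isIntegral_algebraMap
    | add _ _ _ _ h h' => exact h.add h'
    | mul _ _ _ _ h h' => exact h.mul h'
  refine (ringKrullDim_le_of_isIntegral (MvPolynomial (Fin 6) k) A).trans ?_
  exact ringKrullDim_le_card_of_surjective (.id _ _) Function.surjective_id

end KrullDimension

/-! ### Zariski dimension in coordinates -/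

section Coordinates

open MvPolynomial

variable {k : Type*} [Field k] {V : Type*} [AddCommGroup V] [Module k V]

/-- The coordinates of a linear form with respect to the dual basis. -/
def coords (B : Module.Basis (Fin 8) k V) (ξ : Module.Dual k V) : Fin 8 → k := fun i => ξ (B i)

lemma coords_injective (B : Module.Basis (Fin 8) k V) : Function.Injective (coords B) :=
  fun _ _ h => B.ext fun i => congrFun h i

lemma exists_coords_eq (B : Module.Basis (Fin 8) k V) (x : Fin 8 → k) : ∃ ξ, coords B ξ = x :=
  ⟨B.constr k x, funext fun i => B.constr_basis k x i⟩

lemma evalDual_eq (B : Module.Basis (Fin 8) k V) (ξ : Module.Dual k V)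
    (F : SymmetricAlgebra k V) :
    evalDual ξ F = eval (coords B ξ) (SymmetricAlgebra.equivMvPolynomial B F) := by
  have : evalDual ξ = (aeval (coords B ξ) : MvPolynomial (Fin 8) k →ₐ[k] k).comp
      (SymmetricAlgebra.equivMvPolynomial B).toAlgHom := by
    refine SymmetricAlgebra.algHom_ext (B.ext fun i => ?_)
    simp [evalDual, coords]
  exact congrArg (fun φ => φ F) this

lemma adjoin_range_ι_basis (B : Module.Basis (Fin 8) k V) :
    Algebra.adjoin k (Set.range fun i => SymmetricAlgebra.ι k V (B i)) = ⊤ := by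
  have : (SymmetricAlgebra.equivMvPolynomial B).symm.toAlgHom.range = ⊤ :=
    AlgHom.range_eq_top _ |>.2 (SymmetricAlgebra.equivMvPolynomial B).symm.surjective
  rw [← this, ← Algebra.map_top, ← MvPolynomial.adjoin_range_X, AlgHom.map_adjoin, ← Set.range_comp]
  congr 2
  funext i
  simp

lemma mem_vanishing {Z : Set (Module.Dual k V)} {F : SymmetricAlgebra k V} :
    F ∈ vanishing Z ↔ ∀ ξ ∈ Z, evalDual ξ F = 0 := by
  simp [vanishing]

lemma adjoin_range_mk_ι (B : Module.Basis (Fin 8) k V) (I : Ideal (SymmetricAlgebra k V)) :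
    Algebra.adjoin k (Set.range fun i => Ideal.Quotient.mkₐ k I (SymmetricAlgebra.ι k V (B i)))
      = ⊤ := by
  have : (Ideal.Quotient.mkₐ k I).range = ⊤ :=
    (AlgHom.range_eq_top _).2 (Ideal.Quotient.mkₐ_surjective k I)
  rw [← this, ← Algebra.map_top, ← adjoin_range_ι_basis B, AlgHom.map_adjoin, ← Set.range_comp]
  rfl

lemma zariskiDim_univ [CharZero k] (B : Module.Basis (Fin 8) k V) :
    zariskiDim (Set.univ : Set (Module.Dual k V)) = 8 := by
  have h : vanishing (Set.univ : Set (Module.Dual k V)) = ⊥ := by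
    refine (Submodule.eq_bot_iff _).2 fun F hF => ?_
    refine (SymmetricAlgebra.equivMvPolynomial B).injective ?_
    rw [map_zero]
    refine MvPolynomial.funext fun x => ?_
    obtain ⟨ξ, rfl⟩ := exists_coords_eq B x
    rw [← evalDual_eq, mem_vanishing.1 hF ξ trivial, map_zero]
  rw [zariskiDim, h, ringKrullDim_eq_of_ringEquiv (RingEquiv.quotientBot _),
    ringKrullDim_eq_of_ringEquiv (SymmetricAlgebra.equivMvPolynomial B).toRingEquiv,
    MvPolynomial.ringKrullDim_of_isNoetherianRing, ringKrullDim_eq_zero_of_field]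
  simp

lemma zariskiDim_le_six_of_linear (B : Module.Basis (Fin 8) k V) {Z : Set (Module.Dual k V)}
    (hZ : ∀ ξ ∈ Z, coords B ξ 6 = 0 ∧ coords B ξ 7 = 0) : zariskiDim Z ≤ 6 := by
  set q := Ideal.Quotient.mkₐ k (vanishing Z)
  have h6 : q (SymmetricAlgebra.ι k V (B 6)) = 0 :=
    Ideal.Quotient.eq_zero_iff_mem.2 (mem_vanishing.2 fun ξ hξ => by
      simpa [evalDual, coords] using (hZ ξ hξ).1)
  have h7 : q (SymmetricAlgebra.ι k V (B 7)) = 0 :=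
    Ideal.Quotient.eq_zero_iff_mem.2 (mem_vanishing.2 fun ξ hξ => by
      simpa [evalDual, coords] using (hZ ξ hξ).2)
  refine ringKrullDim_le_card_of_surjective (k := k) (m := 6)
    (aeval fun i => q (SymmetricAlgebra.ι k V (B (Fin.castLE (by norm_num) i)))) ?_
  rw [← AlgHom.range_eq_top, ← top_le_iff, ← adjoin_range_mk_ι B, Algebra.adjoin_le_iff]
  rintro _ ⟨i, rfl⟩
  by_cases hi : (i : ℕ) < 6
  · exact ⟨X ⟨i, hi⟩, by simp [q]⟩
  · have : i = 6 ∨ i = 7 := by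
      revert i; decide
    obtain rfl | rfl := this
    · exact ⟨0, by rw [map_zero]; exact h6.symm⟩
    · exact ⟨0, by rw [map_zero]; exact h7.symm⟩

lemma zariskiDim_le_six_of_fibre (B : Module.Basis (Fin 8) k V) {Z : Set (Module.Dual k V)}
    (c₁ c₂ : k) (hZ : ∀ ξ ∈ Z, quadVal (coords B ξ) = c₁ ∧ cubVal (coords B ξ) = c₂) :
    zariskiDim Z ≤ 6 := by
  have key : ∀ F : SymmetricAlgebra k V, ∀ c : k, (∀ ξ ∈ Z, evalDual ξ F = c) →
      Ideal.Quotient.mkₐ k (vanishing Z) F = algebraMap k _ c := by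
    intro F c h
    rw [← sub_eq_zero, ← AlgHom.commutes (Ideal.Quotient.mkₐ k (vanishing Z)), ← map_sub]
    refine Ideal.Quotient.eq_zero_iff_mem.2 (mem_vanishing.2 fun ξ hξ => ?_)
    rw [map_sub, h ξ hξ, AlgHom.commutes]
    simp
  refine ringKrullDim_le_six _ (adjoin_range_mk_ι B (vanishing Z)) c₁ c₂ ?_ ?_
  · rw [← key (2 * (.ι k V (B 3) * .ι k V (B 7)) - 2 * (.ι k V (B 4) * .ι k V (B 6))
      + .ι k V (B 5) ^ 2) c₁ fun ξ hξ => ?_]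
    · simp only [map_add, map_sub, map_mul, map_pow, map_ofNat]
    · rw [← (hZ ξ hξ).1]
      simp only [map_add, map_sub, map_mul, map_pow, map_ofNat, evalDual,
        SymmetricAlgebra.lift_ι_apply, quadVal, coords]
  · rw [← key (.ι k V (B 7) ^ 2 * .ι k V (B 0) + .ι k V (B 6) * .ι k V (B 7) * .ι k V (B 1)
      - .ι k V (B 6) ^ 2 * .ι k V (B 2) + .ι k V (B 5) * (.ι k V (B 3) * .ι k V (B 7) -
      .ι k V (B 6) * .ι k V (B 4)) + algebraMap k _ (1 / 3) * .ι k V (B 5) ^ 3) c₂ fun ξ hξ => ?_]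
    · simp only [map_add, map_sub, map_mul, map_pow, AlgHom.commutes]
    · rw [← (hZ ξ hξ).2]
      simp [evalDual, cubVal, coords]

/-- Cutting `Z` by `x 7 = 1` gives an affine 5-space, and `x 7 - 1` is not a zero divisor on the
closure of `Z`, so the dimension is at least `5 + 1`. No irreducibility of the fibre is needed. -/
lemma six_le_zariskiDim [CharZero k] (B : Module.Basis (Fin 8) k V) {Z : Set (Module.Dual k V)}
    (c₁ c₂ : k)
    (hZ : ∀ ξ, ξ ∈ Z ↔ (coords B ξ 6 ≠ 0 ∨ coords B ξ 7 ≠ 0) ∧ quadVal (coords B ξ) = c₁ ∧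
      cubVal (coords B ξ) = c₂) : 6 ≤ zariskiDim Z := by
  let σ := SymmetricAlgebra.equivMvPolynomial B
  let Y : Set (Fin 8 → k) := {x | (x 6 ≠ 0 ∨ x 7 ≠ 0) ∧ quadVal x = c₁ ∧ cubVal x = c₂}
  have hY : ∀ i t x, i ≠ 1 → x ∈ Y → frameAct i t x ∈ Y := by
    rintro i t x hi ⟨h, h1, h2⟩
    exact ⟨(frameAct_six_seven_ne_zero_iff i t x).2 h, by rw [quadVal_frameAct, h1],
      by rw [cubVal_frameAct, h2]⟩
  have hvan : ∀ F : SymmetricAlgebra k V, F ∈ vanishing Z ↔ ∀ x ∈ Y, eval x (σ F) = 0 := by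
    intro F
    rw [mem_vanishing]
    constructor
    · intro h x hx
      obtain ⟨ξ, rfl⟩ := exists_coords_eq B x
      rw [← evalDual_eq]
      exact h ξ ((hZ ξ).2 hx)
    · intro h ξ hξ
      rw [evalDual_eq B]
      exact h _ ((hZ ξ).1 hξ)
  let s : Fin 8 → MvPolynomial (Fin 5) k :=
    let a := C (c₁ / 2) - C (1 / 2) * X 3 ^ 2 + X 2 * X 4
    ![C c₂ - X 4 * X 0 + X 4 ^ 2 * X 1 - X 3 * (a - X 4 * X 2) - C (1 / 3) * X 3 ^ 3,
      X 0, X 1, a, X 2, X 3, X 4, 1]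
  have hs : ∀ z : Fin 5 → k, (fun i => eval z (s i)) ∈ Y := by
    intro z
    refine ⟨.inr (by simp [s]), ?_, ?_⟩
    · simp [s, quadVal]
      ring
    · simp [s, cubVal]
      ring
  let ψ : SymmetricAlgebra k V →ₐ[k] MvPolynomial (Fin 5) k := (aeval s).comp σ.toAlgHom
  have hψ : ∀ F ∈ vanishing Z, ψ F = 0 := by
    intro F hF
    refine MvPolynomial.funext fun z => ?_
    rw [map_zero, ← (hvan F).1 hF _ (hs z)]
    have : (aeval z : MvPolynomial (Fin 5) k →ₐ[k] k).comp (aeval s) =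
        aeval fun i => eval z (s i) := by
      refine algHom_ext fun i => ?_
      simp
    exact congrArg (fun φ => φ (σ F)) this
  have hψs : Function.Surjective ψ := by
    refine Function.Surjective.comp (g := aeval s) ?_ σ.surjective
    rw [← AlgHom.range_eq_top, ← top_le_iff, ← MvPolynomial.adjoin_range_X, Algebra.adjoin_le_iff]
    rintro _ ⟨i, rfl⟩
    fin_cases i
    exacts [⟨X 1, by simp [s]⟩, ⟨X 2, by simp [s]⟩, ⟨X 4, by simp [s]⟩, ⟨X 5, by simp [s]⟩,
      ⟨X 6, by simp [s]⟩]
  -- The set is stable under the one-parameter groups, which move any of its points off the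
  -- hyperplane `x 7 = 1`.
  have hr : Ideal.Quotient.mk (vanishing Z) (.ι k V (B 7) - 1) ∈
      nonZeroDivisors (SymmetricAlgebra k V ⧸ vanishing Z) := by
    rw [mem_nonZeroDivisors_iff_right]
    intro w hw
    obtain ⟨F, rfl⟩ := Ideal.Quotient.mk_surjective w
    rw [← map_mul, Ideal.Quotient.eq_zero_iff_mem, hvan] at hw
    rw [Ideal.Quotient.eq_zero_iff_mem, hvan]
    refine fun x hx => eval_eq_zero_of_mul_sub_one hY (fun x hx => hx.1) (fun x hx => ?_) hx
    have := hw x hx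
    rw [map_mul, map_sub, map_one, map_mul, map_sub, map_one,
      SymmetricAlgebra.equivMvPolynomial_ι_apply, eval_X] at this
    rw [mul_comm, this]
  have := ringKrullDim_succ_le_of_surjective (Ideal.Quotient.lift (vanishing Z) ψ.toRingHom hψ)
    (Ideal.Quotient.lift_surjective_of_surjective _ _ hψs) hr (by simp [ψ, σ, s])
  rw [MvPolynomial.ringKrullDim_of_isNoetherianRing, ringKrullDim_eq_zero_of_field] at this
  refine le_trans (le_of_eq ?_) this
  simp
  norm_num

end Coordinates

/-! ### Consequences of a frame: orbits, codimension and invariants -/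

section Frames

set_option linter.unusedSectionVars false

variable {n : Type*} [Fintype n] [DecidableEq n] {k : Type*} [Field k] [CharZero k]

/-- This is `Ad (exp (t X)) = exp (t ad X)`. The series stops at `t ^ 4` because `ad X` is a
difference of two commuting operators of cube zero. -/
lemma nilExp_mul_mul_nilExp_neg {X Y : Matrix n n k} (hX : X * X * X = 0) (t : k) :
    nilExp X t * Y * nilExp X (-t) = Y + t • ⁅X, Y⁆ + (t ^ 2 / 2) • ⁅X, ⁅X, Y⁆⁆ +
      (t ^ 3 / 6) • ⁅X, ⁅X, ⁅X, Y⁆⁆⁆ + (t ^ 4 / 24) • ⁅X, ⁅X, ⁅X, ⁅X, Y⁆⁆⁆⁆ := by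
  have h3 : X * (X * X) = 0 := by rw [← mul_assoc, hX]
  have h3' : ∀ Z, X * (X * (X * Z)) = 0 := fun Z => by
    rw [← mul_assoc X X, ← mul_assoc, hX, zero_mul]
  simp only [nilExp, Ring.lie_def, add_mul, mul_add, mul_sub, sub_mul, one_mul, mul_one,
    smul_mul_assoc, mul_smul_comm, mul_assoc, h3, h3', mul_zero]
  module

/-- A basis of the Lie algebra of `Q` satisfying the relations of `sl₂ ⋉ n`, such that `Q` is
generated by the one-parameter groups of its nilpotent elements. -/
structure IsFrame (Q : Subgroup (GL n k)) (B : Module.Basis (Fin 8) k (lieAlg Q)) : Prop where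
  rel : SemidirectRelations (k := k) (B 0) (B 1) (B 2) (B 3) (B 4) (B 5) (B 6) (B 7)
  nil : ∀ i, i ≠ 1 → (B i : Matrix n n k) * (B i : Matrix n n k) * (B i : Matrix n n k) = 0
  mem : ∀ i hi t, nilExpUnit (B i : Matrix n n k) (nil i hi) t ∈ Q
  le_closure : Q ≤ Subgroup.closure {g | ∃ i hi t, g = nilExpUnit (B i : Matrix n n k) (nil i hi) t}

variable {Q : Subgroup (GL n k)} {B : Module.Basis (Fin 8) k (lieAlg Q)}

lemma adjointRep_nilExpUnit {X Y : lieAlg Q} (hX : (X : Matrix n n k) * X * X = 0) (t : k)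
    (h : nilExpUnit (X : Matrix n n k) hX t ∈ Q) :
    adjointRep Q ⟨_, h⟩ Y = Y + t • ⁅X, Y⁆ + (t ^ 2 / 2) • ⁅X, ⁅X, Y⁆⁆ +
      (t ^ 3 / 6) • ⁅X, ⁅X, ⁅X, Y⁆⁆⁆ + (t ^ 4 / 24) • ⁅X, ⁅X, ⁅X, ⁅X, Y⁆⁆⁆⁆ := by
  refine Subtype.ext ?_
  change nilExp (X : Matrix n n k) t * Y * ((nilExpUnit _ hX t)⁻¹ : GL n k) = _
  rw [coe_nilExpUnit_inv, coe_nilExpUnit, nilExp_mul_mul_nilExp_neg hX]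
  simp

lemma coadjointRep_apply (g : Q) (ξ : Module.Dual k (lieAlg Q)) (Y : lieAlg Q) :
    coadjointRep Q g ξ Y = ξ (adjointRep Q g⁻¹ Y) := rfl

lemma coadjointRep_mul_apply (g g' : Q) (ξ : Module.Dual k (lieAlg Q)) :
    coadjointRep Q (g * g') ξ = coadjointRep Q g (coadjointRep Q g' ξ) := by
  rw [map_mul, Module.End.mul_apply]

lemma SemidirectRelations.apply_exp_ad {L : Type*} [LieRing L] [LieAlgebra k L] {x : Fin 8 → L}
    (r : SemidirectRelations (k := k) (x 0) (x 1) (x 2) (x 3) (x 4) (x 5) (x 6) (x 7))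
    (ξ : Module.Dual k L) (i : Fin 8) (hi : i ≠ 1) (t : k) (j : Fin 8) :
    ξ (x j + t • ⁅x i, x j⁆ + (t ^ 2 / 2) • ⁅x i, ⁅x i, x j⁆⁆ +
      (t ^ 3 / 6) • ⁅x i, ⁅x i, ⁅x i, x j⁆⁆⁆ + (t ^ 4 / 24) • ⁅x i, ⁅x i, ⁅x i, ⁅x i, x j⁆⁆⁆⁆) =
    frameAct i t (fun i => ξ (x i)) j := by
  have skew : ∀ {x y z : L}, ⁅x, y⁆ = z → ⁅y, x⁆ = -z := fun h => by
    rw [← lie_skew, h]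
  fin_cases i
  · fin_cases j <;> simp [frameAct, skew r.h_e, r.e_f, r.e_a₁, r.e_b₁,
      r.e_u, r.e_a₂, r.e_b₂] <;>
      ring
  · exact absurd rfl hi
  · fin_cases j <;> simp [frameAct, skew r.e_f, skew r.h_f, r.f_a₁, r.f_b₁,
      r.f_u, r.f_a₂, r.f_b₂] <;>
      ring
  · fin_cases j <;> simp [frameAct, skew r.e_a₁, skew r.h_a₁, skew r.f_a₁, r.a₁_b₁,
      r.a₁_u, r.a₁_a₂, r.a₁_b₂] <;>
      ring
  · fin_cases j <;> simp [frameAct, skew r.e_b₁, skew r.h_b₁, skew r.f_b₁, skew r.a₁_b₁,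
      r.b₁_u, r.b₁_a₂, r.b₁_b₂] <;>
      ring
  · fin_cases j <;> simp [frameAct, skew r.e_u, skew r.h_u, skew r.f_u, skew r.a₁_u,
      skew r.b₁_u, r.u_a₂, r.u_b₂] <;>
      ring
  · fin_cases j <;> simp [frameAct, skew r.e_a₂, skew r.h_a₂, skew r.f_a₂, skew r.a₁_a₂,
      skew r.b₁_a₂, skew r.u_a₂, r.a₂_b₂] <;>
      ring
  · fin_cases j <;> simp [frameAct, skew r.e_b₂, skew r.h_b₂, skew r.f_b₂, skew r.a₁_b₂,
      skew r.b₁_b₂, skew r.u_b₂, skew r.a₂_b₂] <;>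
      ring

/-- The inverse appears because the coadjoint action composes a form with `Ad g⁻¹`, whereas
`frameAct` is composition with `exp (t ad (B i))`. -/
lemma IsFrame.coords_coadjointRep_inv (h : IsFrame Q B) (i : Fin 8) (hi : i ≠ 1) (t : k)
    (ξ : Module.Dual k (lieAlg Q)) :
    coords B (coadjointRep Q ⟨_, h.mem i hi t⟩⁻¹ ξ) = frameAct i t (coords B ξ) := by
  funext j
  rw [coords, coadjointRep_apply, inv_inv, adjointRep_nilExpUnit]
  exact h.rel.apply_exp_ad ξ i hi t j

lemma IsFrame.exists_of_frameReach (h : IsFrame Q B) {ξ : Module.Dual k (lieAlg Q)}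
    {y : Fin 8 → k} (hy : FrameReach (coords B ξ) y) :
    ∃ g : Q, coords B (coadjointRep Q g ξ) = y := by
  induction hy with
  | refl => exact ⟨1, by simp⟩
  | tail _ hs ih =>
    obtain ⟨g, hg⟩ := ih
    obtain ⟨i, t, hi, rfl⟩ := hs
    refine ⟨⟨_, h.mem i hi t⟩⁻¹ * g, ?_⟩
    rw [map_mul, Module.End.mul_apply, h.coords_coadjointRep_inv i hi t, hg]

/-- Invariance under the generators suffices. The target `α` is arbitrary so that the lemma also
covers predicates. -/
lemma IsFrame.apply_coords_coadjointRep (h : IsFrame Q B) {α : Type*} {F : (Fin 8 → k) → α}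
    (hF : ∀ i t x, i ≠ 1 → F (frameAct i t x) = F x) (g : Q) (ξ : Module.Dual k (lieAlg Q)) :
    F (coords B (coadjointRep Q g ξ)) = F (coords B ξ) := by
  obtain ⟨g, hg⟩ := g
  have hc := h.le_closure hg
  induction hc using Subgroup.closure_induction'' generalizing ξ with
  | mem g hg' =>
    obtain ⟨i, hi, t, rfl⟩ := hg'
    have h1 := h.coords_coadjointRep_inv i hi t (coadjointRep Q ⟨_, h.mem i hi t⟩ ξ)
    rw [← Module.End.mul_apply, ← map_mul, inv_mul_cancel, map_one, Module.End.one_apply] at h1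
    rw [h1, hF i t _ hi]
  | inv_mem g hg' =>
    obtain ⟨i, hi, t, rfl⟩ := hg'
    have h1 := h.coords_coadjointRep_inv i hi t ξ
    rw [← hF i t (coords B ξ) hi, ← h1]
    rfl
  | one =>
    have : coadjointRep Q ⟨1, hg⟩ = 1 := map_one _
    rw [this, Module.End.one_apply]
  | mul g g' hgc hgc' ih ih' =>
    have hsub : Subgroup.closure
        {g | ∃ i hi t, g = nilExpUnit (B i : Matrix n n k) (h.nil i hi) t} ≤ Q := by
      rw [Subgroup.closure_le]
      rintro _ ⟨i, hi, t, rfl⟩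
      exact h.mem i hi t
    have : coadjointRep Q ⟨g * g', hg⟩ ξ = coadjointRep Q ⟨g, hsub hgc⟩
        (coadjointRep Q ⟨g', hsub hgc'⟩ ξ) :=
      coadjointRep_mul_apply ⟨g, hsub hgc⟩ ⟨g', hsub hgc'⟩ ξ
    rw [this, ih, ih']

/-- Two such forms with equal invariants can be moved to the same point of the slice. -/
lemma IsFrame.mem_coadjointOrbit_iff (h : IsFrame Q B) {η : Module.Dual k (lieAlg Q)}
    (hη : coords B η 6 ≠ 0 ∨ coords B η 7 ≠ 0) (ξ : Module.Dual k (lieAlg Q)) :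
    ξ ∈ coadjointOrbit Q η ↔ (coords B ξ 6 ≠ 0 ∨ coords B ξ 7 ≠ 0) ∧
      quadVal (coords B ξ) = quadVal (coords B η) ∧ cubVal (coords B ξ) = cubVal (coords B η) := by
  constructor
  · rintro ⟨g, rfl⟩
    refine ⟨?_, h.apply_coords_coadjointRep (fun i t x _ => quadVal_frameAct i t x) g η,
      h.apply_coords_coadjointRep (fun i t x _ => cubVal_frameAct i t x) g η⟩
    exact (h.apply_coords_coadjointRep (F := fun x => x 6 ≠ 0 ∨ x 7 ≠ 0)
      (fun i t x _ => propext (frameAct_six_seven_ne_zero_iff i t x)) g η).mpr hη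
  · rintro ⟨hξ, h1, h2⟩
    obtain ⟨g, hg⟩ := h.exists_of_frameReach (exists_frameReach_slice _ hξ)
    obtain ⟨g', hg'⟩ := h.exists_of_frameReach (exists_frameReach_slice _ hη)
    rw [h1, h2, ← hg'] at hg
    have h3 := coords_injective B hg
    refine ⟨g⁻¹ * g', ?_⟩
    change coadjointRep Q (g⁻¹ * g') η = ξ
    rw [map_mul, Module.End.mul_apply, ← h3, ← Module.End.mul_apply, ← map_mul, inv_mul_cancel,
      map_one, Module.End.one_apply]

/-- No orbit exceeds dimension 6, and orbits outside `x 6 = x 7 = 0` attain it. It does not matter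
whether forms in this subspace are regular. -/
lemma IsFrame.hasCodimTwoProperty (h : IsFrame Q B) : HasCodimTwoProperty Q := by
  have hle : ∀ η, zariskiDim (coadjointOrbit Q η) ≤ 6 := by
    intro η
    refine zariskiDim_le_six_of_fibre B (quadVal (coords B η)) (cubVal (coords B η)) ?_
    rintro _ ⟨g, rfl⟩
    exact ⟨h.apply_coords_coadjointRep (fun i t x _ => quadVal_frameAct i t x) g η,
      h.apply_coords_coadjointRep (fun i t x _ => cubVal_frameAct i t x) g η⟩
  have hreg : ∀ η ∈ (regularSet Q)ᶜ, coords B η 6 = 0 ∧ coords B η 7 = 0 := by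
    intro η hη
    by_contra hc
    rw [not_and_or] at hc
    refine hη fun η' => (hle η').trans ?_
    exact six_le_zariskiDim B _ _ (h.mem_coadjointOrbit_iff hc)
  rw [HasCodimTwoProperty, zariskiDim_univ B]
  refine (add_le_add_left (zariskiDim_le_six_of_linear B hreg) 2).trans (le_of_eq ?_)
  norm_num

open MvPolynomial in
lemma equivMvPolynomial_quadraticInvariant {V : Type*} [AddCommGroup V] [Module k V]
    (B : Module.Basis (Fin 8) k V) :
    SymmetricAlgebra.equivMvPolynomial B
      (quadraticInvariant (k := k) (B 3) (B 4) (B 5) (B 6) (B 7)) = quadPoly k := by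
  simp only [quadraticInvariant, quadPoly, map_add, map_sub, map_mul, map_pow, map_ofNat,
    SymmetricAlgebra.equivMvPolynomial_ι_apply]

open MvPolynomial in
lemma equivMvPolynomial_cubicInvariant {V : Type*} [AddCommGroup V] [Module k V]
    (B : Module.Basis (Fin 8) k V) :
    SymmetricAlgebra.equivMvPolynomial B
      (cubicInvariant (k := k) (B 0) (B 1) (B 2) (B 3) (B 4) (B 5) (B 6) (B 7)) = cubPoly k := by
  simp only [cubicInvariant, cubPoly, map_add, map_sub, map_mul, map_pow, map_smul,
    SymmetricAlgebra.equivMvPolynomial_ι_apply, MvPolynomial.smul_eq_C_mul]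

lemma quadraticInvariant_mem_homogeneousPart {V : Type*} [AddCommGroup V] [Module k V]
    (a₁ b₁ u a₂ b₂ : V) :
    quadraticInvariant (k := k) a₁ b₁ u a₂ b₂ ∈ homogeneousPart k V 2 := by
  have hm : ∀ x y : V, SymmetricAlgebra.ι k V x * SymmetricAlgebra.ι k V y ∈
      homogeneousPart k V 2 := fun x y => by
    rw [homogeneousPart, pow_two]
    exact Submodule.mul_mem_mul ⟨x, rfl⟩ ⟨y, rfl⟩
  simp only [quadraticInvariant, two_mul, pow_two]
  exact add_mem (sub_mem (add_mem (hm _ _) (hm _ _)) (add_mem (hm _ _) (hm _ _))) (hm _ _)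

lemma cubicInvariant_mem_homogeneousPart {V : Type*} [AddCommGroup V] [Module k V]
    (e h f a₁ b₁ u a₂ b₂ : V) :
    cubicInvariant (k := k) e h f a₁ b₁ u a₂ b₂ ∈ homogeneousPart k V 3 := by
  have hm : ∀ x y z : V, SymmetricAlgebra.ι k V x * SymmetricAlgebra.ι k V y *
      SymmetricAlgebra.ι k V z ∈ homogeneousPart k V 3 := fun x y z => by
    rw [homogeneousPart, pow_succ, pow_two]
    exact Submodule.mul_mem_mul (Submodule.mul_mem_mul ⟨x, rfl⟩ ⟨y, rfl⟩) ⟨z, rfl⟩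
  simp only [cubicInvariant, mul_sub, ← mul_assoc, pow_succ, pow_zero, one_mul]
  exact add_mem (add_mem (sub_mem (add_mem (hm _ _ _) (hm _ _ _)) (hm _ _ _))
    (sub_mem (hm _ _ _) (hm _ _ _))) (Submodule.smul_mem _ _ (hm _ _ _))

open MvPolynomial in
lemma IsFrame.coadjointInvariants_eq (h : IsFrame Q B) :
    coadjointInvariants Q = Algebra.adjoin k
      {quadraticInvariant (k := k) (B 3) (B 4) (B 5) (B 6) (B 7),
        cubicInvariant (k := k) (B 0) (B 1) (B 2) (B 3) (B 4) (B 5) (B 6) (B 7)} := by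
  apply le_antisymm
  · intro F hF
    let σ := SymmetricAlgebra.equivMvPolynomial B
    have hinv : ∀ i t x, i ≠ 1 → eval (frameAct i t x) (σ F) = eval x (σ F) := by
      intro i t x hi
      obtain ⟨ξ, rfl⟩ := exists_coords_eq B x
      rw [← h.coords_coadjointRep_inv i hi t ξ, ← evalDual_eq, ← evalDual_eq]
      exact hF _ _
    have h1 := eq_aeval_of_invariant hinv
    rw [← equivMvPolynomial_quadraticInvariant B, ← equivMvPolynomial_cubicInvariant B] at h1
    have h2 : F = aeval ![quadraticInvariant (k := k) (B 3) (B 4) (B 5) (B 6) (B 7),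
        cubicInvariant (k := k) (B 0) (B 1) (B 2) (B 3) (B 4) (B 5) (B 6) (B 7)]
        (restrictSlice k (σ F)) := by
      refine σ.injective (h1.trans ?_)
      have : (σ : SymmetricAlgebra k (lieAlg Q) →ₐ[k] MvPolynomial (Fin 8) k).comp
          (aeval ![quadraticInvariant (k := k) (B 3) (B 4) (B 5) (B 6) (B 7),
          cubicInvariant (k := k) (B 0) (B 1) (B 2) (B 3) (B 4) (B 5) (B 6) (B 7)]) =
          aeval ![σ (quadraticInvariant (k := k) (B 3) (B 4) (B 5) (B 6) (B 7)),
          σ (cubicInvariant (k := k) (B 0) (B 1) (B 2) (B 3) (B 4) (B 5) (B 6) (B 7))] := by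
        refine algHom_ext fun i => ?_
        fin_cases i <;> simp
      exact congrArg (fun φ => φ (restrictSlice k (σ F))) this.symm
    rw [h2, ← Matrix.range_cons_cons_empty _ _ ![], Algebra.adjoin_range_eq_range_aeval]
    exact ⟨_, rfl⟩
  · rw [Algebra.adjoin_le_iff]
    rintro _ (rfl | rfl) g ξ
    · rw [evalDual_eq B, evalDual_eq B, equivMvPolynomial_quadraticInvariant, eval_quadPoly,
        eval_quadPoly]
      exact h.apply_coords_coadjointRep (fun i t x _ => quadVal_frameAct i t x) g ξ
    · rw [evalDual_eq B, evalDual_eq B, equivMvPolynomial_cubicInvariant, eval_cubPoly,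
        eval_cubPoly]
      exact h.apply_coords_coadjointRep (fun i t x _ => cubVal_frameAct i t x) g ξ

/-- Restriction to the slice sends the two elements to the two variables. -/
lemma algebraicIndependent_invariants {V : Type*} [AddCommGroup V] [Module k V]
    (B : Module.Basis (Fin 8) k V) :
    AlgebraicIndependent k ![quadraticInvariant (k := k) (B 3) (B 4) (B 5) (B 6) (B 7),
      cubicInvariant (k := k) (B 0) (B 1) (B 2) (B 3) (B 4) (B 5) (B 6) (B 7)] := by
  refine AlgebraicIndependent.of_comp
    ((restrictSlice k).comp (SymmetricAlgebra.equivMvPolynomial B).toAlgHom) ?_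
  convert MvPolynomial.algebraicIndependent_X (Fin 2) k using 1
  funext i
  fin_cases i
  · change restrictSlice k (SymmetricAlgebra.equivMvPolynomial B _) = _
    exact (congrArg _ (equivMvPolynomial_quadraticInvariant B)).trans restrictSlice_quadPoly
  · change restrictSlice k (SymmetricAlgebra.equivMvPolynomial B _) = _
    exact (congrArg _ (equivMvPolynomial_cubicInvariant B)).trans restrictSlice_cubPoly

end Frames

/-! ### Derivations killing a weight vector or the diagonal -/

section StandardStabilizer

variable {k : Type*} [Field k]

lemma IsDer.entries {X : Matrix (Fin 8) (Fin 8) k} (h : IsDer X) (i j l : Fin 8) :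
    ∑ m, X l m * octMul (Pi.single i 1) (Pi.single j 1) m =
      octMul (fun m => X m i) (Pi.single j 1) l + octMul (Pi.single i 1) (fun m => X m j) l := by
  have := congrFun (h (Pi.single i 1) (Pi.single j 1)) l
  rw [Matrix.mulVec_single_one, Matrix.mulVec_single_one] at this
  exact this

/-- The highest weight vector of the standard stabilizer. -/
def stdVec (k : Type*) [Field k] : Fin 8 → k := ![0, 1, 0, 0, 0, 0, 0, 0]

/-- The general derivation of the octonions that kills `stdVec`. -/
def stabMat (s : Fin 8 → k) : Matrix (Fin 8) (Fin 8) k :=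
  !![0, 0, -s 4, s 3, -2 * s 5, 0, 0, 0;
    2 * s 5, 0, 6 * s 7, -6 * s 6, 0, s 3, s 4, -2 * s 5;
    0, 0, s 1, s 0, -s 3, 0, 0, 0;
    0, 0, s 2, -s 1, -s 4, 0, 0, 0;
    0, 0, 0, 0, 0, 0, 0, 0;
    s 4, 0, 0, -2 * s 5, -6 * s 7, -s 1, -s 2, -s 4;
    -s 3, 0, 2 * s 5, 0, 6 * s 6, -s 0, s 1, s 3;
    0, 0, s 4, -s 3, 2 * s 5, 0, 0, 0]

lemma stabMat_mulVec (s x : Fin 8 → k) : stabMat s *ᵥ x =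
    ![s 3 * x 3 - s 4 * x 2 - 2 * s 5 * x 4,
      s 3 * x 5 + s 4 * x 6 + 2 * s 5 * (x 0 - x 7) - 6 * s 6 * x 3 + 6 * s 7 * x 2,
      s 0 * x 3 + s 1 * x 2 - s 3 * x 4,
      s 2 * x 2 - s 1 * x 3 - s 4 * x 4,
      0,
      s 4 * (x 0 - x 7) - 2 * s 5 * x 3 - 6 * s 7 * x 4 - s 1 * x 5 - s 2 * x 6,
      s 3 * (x 7 - x 0) + 2 * s 5 * x 2 + 6 * s 6 * x 4 - s 0 * x 5 + s 1 * x 6,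
      s 4 * x 2 - s 3 * x 3 + 2 * s 5 * x 4] := by
  funext i
  fin_cases i <;> simp [stabMat, Matrix.mulVec, dotProduct, Fin.sum_univ_eight] <;> ring

lemma isDer_stabMat (s : Fin 8 → k) : IsDer (stabMat s) := by
  intro x y
  simp only [stabMat_mulVec]
  funext i
  fin_cases i <;> simp [octMul] <;> ring

lemma stabMat_mulVec_stdVec (s : Fin 8 → k) : stabMat s *ᵥ stdVec k = 0 := by
  rw [stabMat_mulVec]
  funext i
  fin_cases i <;> simp [stdVec]

set_option maxHeartbeats 2000000 in
lemma eq_stabMat_of_isDer [CharZero k] {X : Matrix (Fin 8) (Fin 8) k} (h : IsDer X)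
    (hX : X *ᵥ stdVec k = 0) :
    X = stabMat ![X 2 3, X 2 2, X 3 2, X 0 3, -X 0 2, X 1 0 / 2, -X 1 3 / 6, X 1 2 / 6] := by
  have h1 : ∀ i, X i 1 = 0 := fun i => by
    simpa [stdVec, Matrix.mulVec, dotProduct, Fin.sum_univ_eight] using congrFun hX i
  have q := h.entries
  -- Here `qijl` is the coordinate `l` of the Leibniz rule for the basis vectors `i` and `j`. These
  -- linear equations suffice to determine every entry of `X`.
  have q000 := q 0 0 0; have q007 := q 0 0 7; have q015 := q 0 1 5; have q016 := q 0 1 6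
  have q017 := q 0 1 7; have q025 := q 0 2 5; have q036 := q 0 3 6; have q041 := q 0 4 1
  have q052 := q 0 5 2; have q063 := q 0 6 3; have q070 := q 0 7 0; have q122 := q 1 2 2
  have q124 := q 1 2 4; have q127 := q 1 2 7; have q133 := q 1 3 3; have q134 := q 1 3 4
  have q137 := q 1 3 7; have q170 := q 1 7 0; have q171 := q 1 7 1; have q175 := q 1 7 5
  have q176 := q 1 7 6; have q210 := q 2 1 0; have q310 := q 3 1 0; have q024 := q 0 2 4
  have q026 := q 0 2 6; have q027 := q 0 2 7; have q034 := q 0 3 4; have q035 := q 0 3 5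
  have q037 := q 0 3 7; have q040 := q 0 4 0; have q042 := q 0 4 2; have q043 := q 0 4 3
  have q051 := q 0 5 1; have q061 := q 0 6 1; have q071 := q 0 7 1; have q125 := q 1 2 5
  have q126 := q 1 2 6; have q135 := q 1 3 5; have q136 := q 1 3 6; have q140 := q 1 4 0
  have q141 := q 1 4 1; have q200 := q 2 0 0; have q235 := q 2 3 5; have q236 := q 2 3 6
  have q270 := q 2 7 0; have q300 := q 3 0 0; have q370 := q 3 7 0; have q561 := q 5 6 1
  simp [octMul, Fin.sum_univ_eight, h1]
    at q000 q007 q015 q016 q017 q025 q036 q041 q052 q063 q070 q122 q124 q127 q133 q134 q137 q170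
      q171 q175 q176 q210 q310 q024 q026 q027 q034 q035 q037 q040 q042 q043 q051 q061 q071 q125
      q126 q135 q136 q140 q141 q200 q235 q236 q270 q300 q370 q561
  ext i j
  fin_cases i <;> fin_cases j <;> simp [stabMat, h1] <;> grind

/-- The matrix of the derivation of the octonions given by a traceless `3 × 3` matrix. -/
def blockMat (A : Matrix (Fin 3) (Fin 3) k) : Matrix (Fin 8) (Fin 8) k :=
  !![0, 0, 0, 0, 0, 0, 0, 0;
    0, A 0 0, A 0 1, A 0 2, 0, 0, 0, 0;
    0, A 1 0, A 1 1, A 1 2, 0, 0, 0, 0;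
    0, A 2 0, A 2 1, A 2 2, 0, 0, 0, 0;
    0, 0, 0, 0, -A 0 0, -A 1 0, -A 2 0, 0;
    0, 0, 0, 0, -A 0 1, -A 1 1, -A 2 1, 0;
    0, 0, 0, 0, -A 0 2, -A 1 2, -A 2 2, 0;
    0, 0, 0, 0, 0, 0, 0, 0]

set_option maxHeartbeats 2000000 in
-- The derivations killing a diagonal idempotent form `sl₃`, acting on the off-diagonal vectors by
-- the standard representation and its dual.
lemma exists_eq_blockMat_of_isDer [CharZero k] {X : Matrix (Fin 8) (Fin 8) k} (h : IsDer X)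
    (h0 : ∀ i, X i 0 = 0) : ∃ A : Matrix (Fin 3) (Fin 3) k, A.trace = 0 ∧ X = blockMat A := by
  have q := h.entries
  have q014 := q 0 1 4; have q015 := q 0 1 5; have q016 := q 0 1 6; have q017 := q 0 1 7
  have q024 := q 0 2 4; have q025 := q 0 2 5; have q026 := q 0 2 6; have q027 := q 0 2 7
  have q034 := q 0 3 4; have q035 := q 0 3 5; have q036 := q 0 3 6; have q037 := q 0 3 7
  have q040 := q 0 4 0; have q041 := q 0 4 1; have q042 := q 0 4 2; have q043 := q 0 4 3
  have q050 := q 0 5 0; have q051 := q 0 5 1; have q052 := q 0 5 2; have q053 := q 0 5 3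
  have q060 := q 0 6 0; have q061 := q 0 6 1; have q062 := q 0 6 2; have q063 := q 0 6 3
  have q070 := q 0 7 0; have q071 := q 0 7 1; have q072 := q 0 7 2; have q073 := q 0 7 3
  have q100 := q 1 0 0; have q141 := q 1 4 1; have q171 := q 1 7 1; have q200 := q 2 0 0
  have q252 := q 2 5 2; have q300 := q 3 0 0; have q363 := q 3 6 3; have q704 := q 7 0 4
  have q705 := q 7 0 5; have q706 := q 7 0 6; have q124 := q 1 2 4; have q125 := q 1 2 5
  have q134 := q 1 3 4; have q136 := q 1 3 6; have q140 := q 1 4 0; have q235 := q 2 3 5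
  have q236 := q 2 3 6; have q250 := q 2 5 0; have q360 := q 3 6 0; have q126 := q 1 2 6
  simp [octMul, Fin.sum_univ_eight, h0]
    at q014 q015 q016 q017 q024 q025 q026 q027 q034 q035 q036 q037 q040 q041 q042 q043 q050 q051
      q052 q053 q060 q061 q062 q063 q070 q071 q072 q073 q100 q141 q171 q200 q252 q300 q363 q704
      q705 q706 q124 q125 q134 q136 q140 q235 q236 q250 q360 q126
  refine ⟨!![X 1 1, X 1 2, X 1 3; X 2 1, X 2 2, X 2 3; X 3 1, X 3 2, X 3 3], ?_, ?_⟩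
  · simp [Matrix.trace, Fin.sum_univ_three]
    grind
  · ext i j
    fin_cases i <;> fin_cases j <;> simp [blockMat, h0] <;> grind

end StandardStabilizer

/-! ### The standard basis of the stabilizer and its one-parameter groups -/

section StandardFrame

variable {k : Type*} [Field k]

/-- The bracket of `stabMat s` and `stabMat r` in coordinates. -/
def stabBracket (s r : Fin 8 → k) : Fin 8 → k :=
  ![2 * (s 1 * r 0 - s 0 * r 1),
    s 0 * r 2 - s 2 * r 0,
    -2 * (s 1 * r 2 - s 2 * r 1),
    s 1 * r 3 - s 3 * r 1 + (s 0 * r 4 - s 4 * r 0),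
    -(s 1 * r 4 - s 4 * r 1) + (s 2 * r 3 - s 3 * r 2),
    s 3 * r 4 - s 4 * r 3,
    s 1 * r 6 - s 6 * r 1 + (s 0 * r 7 - s 7 * r 0) + (s 3 * r 5 - s 5 * r 3),
    -(s 1 * r 7 - s 7 * r 1) + (s 2 * r 6 - s 6 * r 2) + (s 4 * r 5 - s 5 * r 4)]

/-- The factors 2 and 6 in `stabMat` absorb the structure constants, so that `[a₁, b₁]`, `[a₁, u]`,
`[b₁, u]` are `u`, `a₂`, `b₂` with coefficient one. -/
lemma lie_stabMat (s r : Fin 8 → k) :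
    ⁅stabMat s, stabMat r⁆ = stabMat (stabBracket s r) := by
  refine Matrix.toLin'.injective (LinearMap.ext fun x => ?_)
  simp only [Matrix.toLin'_apply, Ring.lie_def, Matrix.sub_mulVec, ← Matrix.mulVec_mulVec,
    stabMat_mulVec]
  funext i
  fin_cases i <;> simp [stabBracket] <;> ring

/-- `stabMat` as a linear map. -/
def stabLin (k : Type*) [Field k] : (Fin 8 → k) →ₗ[k] Matrix (Fin 8) (Fin 8) k where
  toFun := stabMat
  map_add' s r := by
    refine Matrix.toLin'.injective (LinearMap.ext fun x => ?_)
    simp only [Matrix.toLin'_apply, Matrix.add_mulVec, stabMat_mulVec]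
    funext i
    fin_cases i <;> simp <;> ring
  map_smul' c r := by
    refine Matrix.toLin'.injective (LinearMap.ext fun x => ?_)
    simp only [Matrix.toLin'_apply, Matrix.smul_mulVec, stabMat_mulVec, RingHom.id_apply]
    funext i
    fin_cases i <;> simp <;> ring

lemma stabMat_single_nil (i : Fin 8) (hi : i ≠ 1) :
    stabMat (Pi.single i (1 : k)) * stabMat (Pi.single i 1) * stabMat (Pi.single i 1) = 0 := by
  refine Matrix.toLin'.injective (LinearMap.ext fun x => ?_)
  simp only [Matrix.toLin'_apply, ← Matrix.mulVec_mulVec, stabMat_mulVec, map_zero,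
    LinearMap.zero_apply]
  funext j
  fin_cases i
  all_goals first
  | exact absurd rfl hi
  | (fin_cases j <;> simp)

/-- The isotropy group of `stdVec` in the group of type `G₂`. -/
def stdGroup (k : Type*) [Field k] : Subgroup (GL (Fin 8) k) := isotropy (groupG2 k) (stdVec k)

variable [CharZero k]

lemma nilExpUnit_stabMat_mem {s : Fin 8 → k} (hs : stabMat s * stabMat s * stabMat s = 0) (t : k) :
    nilExpUnit (stabMat s) hs t ∈ stdGroup k := by
  refine ⟨nilExpUnit_mem_groupG2 (isDer_stabMat s) hs t, ?_⟩
  rw [coe_nilExpUnit, nilExp_mulVec, stabMat_mulVec_stdVec]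
  simp

lemma stabMat_mem_lieAlg (s : Fin 8 → k) : stabMat s ∈ lieAlg (stdGroup k) := by
  have h : ∀ i, i ≠ 1 → stabMat (Pi.single i (1 : k)) ∈ lieAlg (stdGroup k) := fun i hi =>
    mem_lieAlg_of_nilExpUnit_mem (stabMat_single_nil i hi) fun t => nilExpUnit_stabMat_mem _ t
  -- The element `h` is not nilpotent; it is obtained as `[e, f]`.
  have h1 : stabMat (Pi.single 1 (1 : k)) ∈ lieAlg (stdGroup k) := by
    have := (lieAlg (stdGroup k)).lie_mem (h 0 (by decide)) (h 2 (by decide))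
    rw [lie_stabMat] at this
    convert! this
    funext i
    fin_cases i <;> simp [stabBracket]
  have hs : stabLin k s = ∑ i, s i • stabLin k (Pi.single i 1) := by
    conv_lhs => rw [pi_eq_sum_univ' s, map_sum]
    exact Finset.sum_congr rfl fun i _ => by rw [map_smul]
  change stabLin k s ∈ lieAlg (stdGroup k)
  rw [hs]
  refine sum_mem fun i _ => (lieAlg (stdGroup k)).smul_mem _ ?_
  by_cases hi : i = 1
  · rw [hi]; exact h1
  · exact h i hi

/-- Coordinates on the Lie algebra of `stdGroup`. -/
def stabEquiv (k : Type*) [Field k] [CharZero k] : (Fin 8 → k) ≃ₗ[k] lieAlg (stdGroup k) :=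
  { (stabLin k).codRestrict (lieAlg (stdGroup k)).toSubmodule stabMat_mem_lieAlg with
    invFun := fun X => ![X.1 2 3, X.1 2 2, X.1 3 2, X.1 0 3, -X.1 0 2, X.1 1 0 / 2, -X.1 1 3 / 6,
      X.1 1 2 / 6]
    left_inv := fun s => by
      funext i
      fin_cases i <;> simp [stabLin, stabMat]
    right_inv := fun X => Subtype.ext (eq_stabMat_of_isDer
      (isDer_of_mem_lieAlg (fun _ (hg : _ ∈ isotropy _ _) => hg.1) X.2)
      (mulVec_eq_zero_of_mem_lieAlg (fun _ (hg : _ ∈ isotropy _ _) => hg.2) X.2)).symm }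

lemma coe_stabEquiv (s : Fin 8 → k) : (stabEquiv k s : Matrix (Fin 8) (Fin 8) k) = stabMat s := rfl

lemma lie_stabEquiv (s r : Fin 8 → k) :
    ⁅stabEquiv k s, stabEquiv k r⁆ = stabEquiv k (stabBracket s r) :=
  Subtype.ext (lie_stabMat s r)

/-- The standard basis of the Lie algebra of `stdGroup`. -/
def stdBasis (k : Type*) [Field k] [CharZero k] : Module.Basis (Fin 8) k (lieAlg (stdGroup k)) :=
  .ofEquivFun (stabEquiv k).symm

lemma stdBasis_apply (i : Fin 8) : stdBasis k i = stabEquiv k (Pi.single i 1) := by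
  simp [stdBasis]

lemma semidirectRelations_stdBasis : SemidirectRelations (k := k) (stdBasis k 0) (stdBasis k 1)
    (stdBasis k 2) (stdBasis k 3) (stdBasis k 4) (stdBasis k 5) (stdBasis k 6) (stdBasis k 7) := by
  constructor <;> simp only [stdBasis_apply, lie_stabEquiv] <;>
    apply (stabEquiv k).symm.injective <;>
    simp only [map_neg, map_smul, map_zero, LinearEquiv.symm_apply_apply] <;>
    funext i <;> fin_cases i <;> simp [stabBracket]

/-- The group generated by the one-parameter groups of the standard nilpotent elements. -/
def stdGens (k : Type*) [Field k] [CharZero k] : Subgroup (GL (Fin 8) k) :=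
  Subgroup.closure {g | ∃ i hi t, g = nilExpUnit (stabMat (Pi.single i 1)) (stabMat_single_nil i hi) t}

lemma stdGens_le : stdGens k ≤ stdGroup k := by
  rw [stdGens, Subgroup.closure_le]
  rintro _ ⟨i, hi, t, rfl⟩
  exact nilExpUnit_stabMat_mem _ t

/-- The vector `y` is obtained from `x` by an element of `stdGens`. -/
def StdReach (x y : Fin 8 → k) : Prop :=
  ∃ g ∈ stdGens k, (g : Matrix (Fin 8) (Fin 8) k) *ᵥ x = y

lemma StdReach.trans {x y z : Fin 8 → k} (h : StdReach x y) (h' : StdReach y z) :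
    StdReach x z := by
  obtain ⟨g, hg, rfl⟩ := h
  obtain ⟨g', hg', rfl⟩ := h'
  exact ⟨g' * g, mul_mem hg' hg, by rw [Units.val_mul, Matrix.mulVec_mulVec]⟩

lemma nilExpUnit_mem_stdGens (i : Fin 8) (hi : i ≠ 1) (t : k) :
    nilExpUnit (stabMat (Pi.single i 1)) (stabMat_single_nil i hi) t ∈ stdGens k :=
  Subgroup.subset_closure ⟨i, hi, t, rfl⟩

lemma StdReach.single (i : Fin 8) (hi : i ≠ 1) (t : k) (x : Fin 8 → k) :
    StdReach x (nilExp (stabMat (Pi.single i 1)) t *ᵥ x) :=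
  ⟨_, nilExpUnit_mem_stdGens i hi t, rfl⟩

/-- The coordinate 4 is fixed by the group. Since it equals `1`, the elements `a₁, b₁, b₂, a₂`
successively clear the coordinates 2, 3, 5, 6, and `u` gives the coordinate 0 any prescribed value.
-/
lemma StdReach.exists_normalForm (x : Fin 8 → k) (h4 : x 4 = 1) (h7 : x 7 = -x 0) (c : k) :
    ∃ z, StdReach x ![c, z, 0, 0, 1, 0, 0, -c] := by
  obtain ⟨y, hy, h4, h7, h2⟩ : ∃ z, StdReach x z ∧ z 4 = 1 ∧ z 7 = -z 0 ∧ z 2 = 0 := by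
    refine ⟨_, .single 3 (by decide) (x 2) x, ?_, ?_, ?_⟩ <;>
      simp [nilExp_mulVec_apply, stabMat_mulVec, h4, h7]
    ring
  obtain ⟨y, hy, h4, h7, h2, h3⟩ :
      ∃ z, StdReach x z ∧ z 4 = 1 ∧ z 7 = -z 0 ∧ z 2 = 0 ∧ z 3 = 0 := by
    refine ⟨_, hy.trans (.single 4 (by decide) (y 3) y), ?_, ?_, ?_, ?_⟩ <;>
      simp [nilExp_mulVec_apply, stabMat_mulVec, h4, h7, h2]
  obtain ⟨y, hy, h4, h7, h2, h3, h5⟩ :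
      ∃ z, StdReach x z ∧ z 4 = 1 ∧ z 7 = -z 0 ∧ z 2 = 0 ∧ z 3 = 0 ∧ z 5 = 0 := by
    refine ⟨_, hy.trans (.single 7 (by decide) (y 5 / 6) y), ?_, ?_, ?_, ?_, ?_⟩ <;>
      simp [nilExp_mulVec_apply, stabMat_mulVec, h4, h7, h2, h3]
  obtain ⟨y, hy, h4, h7, h2, h3, h5, h6⟩ :
      ∃ z, StdReach x z ∧ z 4 = 1 ∧ z 7 = -z 0 ∧ z 2 = 0 ∧ z 3 = 0 ∧ z 5 = 0 ∧ z 6 = 0 := by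
    refine ⟨_, hy.trans (.single 6 (by decide) (-y 6 / 6) y), ?_, ?_, ?_, ?_, ?_, ?_⟩ <;>
      simp [nilExp_mulVec_apply, stabMat_mulVec, h4, h7, h2, h3, h5]
  obtain ⟨y, hy, h4, h7, h2, h3, h5, h6, h0⟩ :
      ∃ z, StdReach x z ∧ z 4 = 1 ∧ z 7 = -z 0 ∧ z 2 = 0 ∧ z 3 = 0 ∧ z 5 = 0 ∧ z 6 = 0 ∧
        z 0 = c := by
    refine ⟨_, hy.trans (.single 5 (by decide) ((y 0 - c) / 2) y), ?_, ?_, ?_, ?_, ?_, ?_, ?_⟩ <;>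
      simp [nilExp_mulVec_apply, stabMat_mulVec, h4, h7, h2, h3, h5, h6]
    ring
  refine ⟨y 1, ?_⟩
  convert hy using 1
  funext i
  fin_cases i <;> simp [*]

end StandardFrame

/-! ### The stabilizer is generated by its one-parameter groups -/

section Generation

variable {k : Type*} [Field k]

/-- The identity of the octonions. -/
def octOne (k : Type*) [Field k] : Fin 8 → k := ![1, 0, 0, 0, 0, 0, 0, 1]

lemma octOne_octMul (x : Fin 8 → k) : octMul (octOne k) x = x := by
  funext i; fin_cases i <;> simp [octMul, octOne]

lemma octMul_octOne (x : Fin 8 → k) : octMul x (octOne k) = x := by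
  funext i; fin_cases i <;> simp [octMul, octOne]

lemma mulVec_octOne_of_mem {g : GL (Fin 8) k} (hg : g ∈ groupG2 k) :
    (g : Matrix (Fin 8) (Fin 8) k) *ᵥ octOne k = octOne k := by
  have h := hg (octOne k) (((g⁻¹ : GL (Fin 8) k) : Matrix (Fin 8) (Fin 8) k) *ᵥ octOne k)
  have h' : (g : Matrix (Fin 8) (Fin 8) k) * ((g⁻¹ : GL (Fin 8) k) : Matrix (Fin 8) (Fin 8) k) = 1 :=
    g.mul_inv
  rw [octOne_octMul, Matrix.mulVec_mulVec, h', Matrix.one_mulVec, octMul_octOne] at h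
  exact h.symm

lemma IsDer.mulVec_octOne {X : Matrix (Fin 8) (Fin 8) k} (h : IsDer X) : X *ᵥ octOne k = 0 := by
  have := h (octOne k) (octOne k)
  rw [octOne_octMul, octMul_octOne, octOne_octMul] at this
  simpa using this

lemma octMul_self_of_traceZero {x : Fin 8 → k} (hx : x 7 = -x 0) :
    octMul x x = (x 0 ^ 2 + (x 1 * x 4 + x 2 * x 5 + x 3 * x 6)) • octOne k := by
  funext i; fin_cases i <;> simp [octMul, octOne, hx] <;> ring

lemma octMul_fixed {g : GL (Fin 8) k} (hg : g ∈ groupG2 k) {x y z : Fin 8 → k}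
    (hx : (g : Matrix (Fin 8) (Fin 8) k) *ᵥ x = x) (hy : (g : Matrix (Fin 8) (Fin 8) k) *ᵥ y = y)
    (h : octMul x y = z) : (g : Matrix (Fin 8) (Fin 8) k) *ᵥ z = z := by
  rw [← h, hg, hx, hy]

/-- The basis vectors 1, 2, 3, 4 generate the octonions as an algebra. -/
lemma eq_one_of_fixes {g : GL (Fin 8) k} (hg : g ∈ groupG2 k)
    (h : ∀ i : Fin 8, i = 1 ∨ i = 2 ∨ i = 3 ∨ i = 4 →
      (g : Matrix (Fin 8) (Fin 8) k) *ᵥ Pi.single i 1 = Pi.single i 1) : g = 1 := by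
  have h1 := h 1 (by decide)
  have h2 := h 2 (by decide)
  have h3 := h 3 (by decide)
  have h4 := h 4 (by decide)
  have h0 : (g : Matrix (Fin 8) (Fin 8) k) *ᵥ Pi.single 0 1 = Pi.single 0 1 :=
    octMul_fixed hg h1 h4 (by funext i; fin_cases i <;> simp [octMul])
  have h7 : (g : Matrix (Fin 8) (Fin 8) k) *ᵥ Pi.single 7 1 = Pi.single 7 1 :=
    octMul_fixed hg h4 h1 (by funext i; fin_cases i <;> simp [octMul])
  have h5 : (g : Matrix (Fin 8) (Fin 8) k) *ᵥ Pi.single 5 1 = Pi.single 5 1 :=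
    octMul_fixed hg h3 h1 (by funext i; fin_cases i <;> simp [octMul])
  have h6 : (g : Matrix (Fin 8) (Fin 8) k) *ᵥ Pi.single 6 1 = Pi.single 6 1 :=
    octMul_fixed hg h1 h2 (by funext i; fin_cases i <;> simp [octMul])
  have hall : ∀ i, (g : Matrix (Fin 8) (Fin 8) k) *ᵥ Pi.single i 1 = Pi.single i 1 := by
    intro i
    fin_cases i
    exacts [h0, h1, h2, h3, h4, h5, h6, h7]
  refine Units.ext (Matrix.toLin'.injective ((Pi.basisFun k (Fin 8)).ext fun i => ?_))
  simpa using hall i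

lemma stdVec_eq : stdVec k = Pi.single 1 1 := by
  funext i; fin_cases i <;> simp [stdVec]

/-- A description of the span of the basis vectors 2 and 3 by products alone; an automorphism fixing
the vectors 0, 4 and 7 therefore preserves it. -/
lemma eq_vec_of_octMul_eq {p : Fin 8 → k} (h0 : octMul (Pi.single 0 1) p = p)
    (h7 : octMul p (Pi.single 7 1) = p) (h4 : octMul (Pi.single 4 1) p = 0) :
    p = ![0, 0, p 2, p 3, 0, 0, 0, 0] := by
  have a4 := congrFun h0 4
  have a5 := congrFun h0 5
  have a6 := congrFun h0 6
  have a7 := congrFun h0 7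
  have b0 := congrFun h7 0
  have c7 := congrFun h4 7
  simp [octMul] at a4 a5 a6 a7 b0 c7
  funext i
  fin_cases i <;> simp [← a4, ← a5, ← a6, ← a7, ← b0, c7]

variable [CharZero k]

lemma StdReach.octMul_self {x y : Fin 8 → k} (h : StdReach x y) {c : k}
    (hx : octMul x x = c • octOne k) : octMul y y = c • octOne k := by
  obtain ⟨g, hg, rfl⟩ := h
  have hg' := (stdGens_le hg).1
  rw [← hg' x x, hx, Matrix.mulVec_smul, mulVec_octOne_of_mem hg']

/-- Traceless octonions with coordinate `1` along the lowest weight vector are conjugate to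
combinations of three weight vectors. -/
lemma StdReach.exists_sqrt {y : Fin 8 → k} (h4 : y 4 = 1) (h7 : y 7 = -y 0) (c : k)
    (hc : octMul y y = c ^ 2 • octOne k) : StdReach y ![c, 0, 0, 0, 1, 0, 0, -c] := by
  obtain ⟨z, hz⟩ := StdReach.exists_normalForm y h4 h7 c
  have h := congrFun (hz.octMul_self hc) 0
  -- The square of the normal form is `(c ^ 2 + z)` times the identity, and squares that are scalar
  -- are preserved.
  have : z = 0 := by
    simp [octMul, octOne] at h
    linear_combination h
  rwa [this] at hz

/-- The image `y` of the lowest weight vector has square zero and satisfies `e₁ y + y e₁ = 1`. The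
latter forces trace zero and coordinate `1` at index 4, so `y` can be moved back by
`StdReach.exists_sqrt` with `c = 0`. -/
lemma exists_mem_stdGens_mul_fixes {g : GL (Fin 8) k} (hg : g ∈ stdGroup k) :
    ∃ n ∈ stdGens k, ((n * g : GL (Fin 8) k) : Matrix (Fin 8) (Fin 8) k) *ᵥ Pi.single 4 1 =
      Pi.single 4 1 := by
  have h1 : (g : Matrix (Fin 8) (Fin 8) k) *ᵥ Pi.single 1 1 = Pi.single 1 1 := by
    simpa [stdVec_eq] using hg.2
  set y := (g : Matrix (Fin 8) (Fin 8) k) *ᵥ Pi.single 4 1 with hy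
  have e44 : octMul (Pi.single 4 (1 : k)) (Pi.single 4 1) = 0 := by
    funext i; fin_cases i <;> simp [octMul]
  have e14 : octMul (Pi.single 1 (1 : k)) (Pi.single 4 1) +
      octMul (Pi.single 4 1) (Pi.single 1 1) = octOne k := by
    funext i; fin_cases i <;> simp [octMul, octOne]
  have hyy : octMul y y = 0 := by rw [hy, ← hg.1, e44, Matrix.mulVec_zero]
  have h1y : octMul (Pi.single 1 1) y + octMul y (Pi.single 1 1) = octOne k := by
    have := congrArg ((g : Matrix (Fin 8) (Fin 8) k) *ᵥ ·) e14
    simp only [Matrix.mulVec_add, hg.1 _ _, h1, mulVec_octOne_of_mem hg.1] at this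
    exact this
  have h4 : y 4 = 1 := by simpa [octMul, octOne] using congrFun h1y 0
  have h7 : y 7 = -y 0 := by
    have := congrFun h1y 1
    simp [octMul, octOne] at this
    linear_combination this
  obtain ⟨n, hn, hny⟩ := StdReach.exists_sqrt h4 h7 0 (by simpa using hyy)
  refine ⟨n, hn, ?_⟩
  rw [Units.val_mul, ← Matrix.mulVec_mulVec, ← hy, hny]
  funext i; fin_cases i <;> simp

/-- Elementary matrices of `SL₂` act transitively on the non-zero vectors of the plane. -/
lemma exists_mem_stdGens_mulVec_eq_single {a b : k} (hab : a ≠ 0 ∨ b ≠ 0) :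
    ∃ n ∈ stdGens k, (n : Matrix (Fin 8) (Fin 8) k) *ᵥ Pi.single 4 1 = Pi.single 4 1 ∧
      (n : Matrix (Fin 8) (Fin 8) k) *ᵥ ![0, 0, a, b, 0, 0, 0, 0] = Pi.single 2 1 := by
  have he : ∀ t a b : k, nilExp (stabMat (Pi.single 0 1)) t *ᵥ ![0, 0, a, b, 0, 0, 0, 0] =
      ![0, 0, a + t * b, b, 0, 0, 0, 0] := fun t a b => by
    funext i
    fin_cases i <;> simp [nilExp_mulVec_apply, stabMat_mulVec]
  have hf : ∀ t a b : k, nilExp (stabMat (Pi.single 2 1)) t *ᵥ ![0, 0, a, b, 0, 0, 0, 0] =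
      ![0, 0, a, b + t * a, 0, 0, 0, 0] := fun t a b => by
    funext i
    fin_cases i <;> simp [nilExp_mulVec_apply, stabMat_mulVec]
  have he4 : ∀ t : k, nilExp (stabMat (Pi.single 0 1)) t *ᵥ Pi.single 4 1 = Pi.single 4 1 :=
    fun t => by
    funext i
    fin_cases i <;> (simp only [nilExp_mulVec_apply, stabMat_mulVec]; simp)
  have hf4 : ∀ t : k, nilExp (stabMat (Pi.single 2 1)) t *ᵥ Pi.single 4 1 = Pi.single 4 1 :=
    fun t => by
    funext i
    fin_cases i <;> (simp only [nilExp_mulVec_apply, stabMat_mulVec]; simp)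
  have key : ∀ a b : k, b ≠ 0 → ∃ n ∈ stdGens k,
      (n : Matrix (Fin 8) (Fin 8) k) *ᵥ Pi.single 4 1 = Pi.single 4 1 ∧
      (n : Matrix (Fin 8) (Fin 8) k) *ᵥ ![0, 0, a, b, 0, 0, 0, 0] = Pi.single 2 1 := by
    intro a b hb
    refine ⟨_, mul_mem (nilExpUnit_mem_stdGens 2 (by decide) (-b))
      (nilExpUnit_mem_stdGens 0 (by decide) ((1 - a) / b)), ?_, ?_⟩
    · rw [Units.val_mul, ← Matrix.mulVec_mulVec, coe_nilExpUnit, coe_nilExpUnit, he4, hf4]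
    · rw [Units.val_mul, ← Matrix.mulVec_mulVec, coe_nilExpUnit, coe_nilExpUnit, he, hf]
      funext i
      fin_cases i <;> simp [hb]
  by_cases hb : b = 0
  · have ha : a ≠ 0 := hab.resolve_right (not_not.2 hb)
    obtain ⟨n, hn, h4, h2⟩ := key a a ha
    refine ⟨_, mul_mem hn (nilExpUnit_mem_stdGens 2 (by decide) 1), ?_, ?_⟩
    · rw [Units.val_mul, ← Matrix.mulVec_mulVec, coe_nilExpUnit, hf4, h4]
    · rw [Units.val_mul, ← Matrix.mulVec_mulVec, coe_nilExpUnit, hf, hb, zero_add, one_mul, h2]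
  · exact key a b hb

lemma stdGroup_le_stdGens : stdGroup k ≤ stdGens k := by
  intro g hg
  obtain ⟨n, hn, hng4⟩ := exists_mem_stdGens_mul_fixes hg
  -- An element that also fixes the vector 4 acts on the plane of the vectors 2 and 3 by a matrix of
  -- determinant one, because their product is the vector 4. It remains to factor this matrix into
  -- elementary ones.
  suffices ∀ g ∈ stdGroup k, (g : Matrix (Fin 8) (Fin 8) k) *ᵥ Pi.single 4 1 = Pi.single 4 1 →
      g ∈ stdGens k from
    (Subgroup.mul_mem_cancel_left _ hn).1 (this _ (mul_mem (stdGens_le hn) hg) hng4)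
  clear hg g hn hng4 n
  have shape : ∀ g ∈ stdGroup k, (g : Matrix (Fin 8) (Fin 8) k) *ᵥ Pi.single 4 1 = Pi.single 4 1 →
      ∃ a b c d : k, a * d - b * c = 1 ∧
        (g : Matrix (Fin 8) (Fin 8) k) *ᵥ Pi.single 2 1 = ![0, 0, a, b, 0, 0, 0, 0] ∧
        (g : Matrix (Fin 8) (Fin 8) k) *ᵥ Pi.single 3 1 = ![0, 0, c, d, 0, 0, 0, 0] := by
    intro g hg h4
    have h1 : (g : Matrix (Fin 8) (Fin 8) k) *ᵥ Pi.single 1 1 = Pi.single 1 1 := by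
      simpa [stdVec_eq] using hg.2
    have h0 : (g : Matrix (Fin 8) (Fin 8) k) *ᵥ Pi.single 0 1 = Pi.single 0 1 :=
      octMul_fixed hg.1 h1 h4 (by funext i; fin_cases i <;> simp [octMul])
    have h7 : (g : Matrix (Fin 8) (Fin 8) k) *ᵥ Pi.single 7 1 = Pi.single 7 1 :=
      octMul_fixed hg.1 h4 h1 (by funext i; fin_cases i <;> simp [octMul])
    have hp : ∀ i : Fin 8, i = 2 ∨ i = 3 → ∃ a b : k,
        (g : Matrix (Fin 8) (Fin 8) k) *ᵥ Pi.single i 1 = ![0, 0, a, b, 0, 0, 0, 0] := by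
      intro i hi
      refine ⟨_, _, eq_vec_of_octMul_eq ?_ ?_ ?_⟩
      · conv_lhs => rw [← h0, ← hg.1]
        congr 1
        obtain rfl | rfl := hi <;> funext j <;> fin_cases j <;> simp [octMul]
      · conv_lhs => rw [← h7, ← hg.1]
        congr 1
        obtain rfl | rfl := hi <;> funext j <;> fin_cases j <;> simp [octMul]
      · rw [← h4, ← hg.1, ← Matrix.mulVec_zero (g : Matrix (Fin 8) (Fin 8) k)]
        congr 1
        obtain rfl | rfl := hi <;> funext j <;> fin_cases j <;> simp [octMul]
    obtain ⟨a, b, hab⟩ := hp 2 (by decide)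
    obtain ⟨c, d, hcd⟩ := hp 3 (by decide)
    refine ⟨a, b, c, d, ?_, hab, hcd⟩
    have h23 : octMul (Pi.single 2 (1 : k)) (Pi.single 3 1) = Pi.single 4 1 := by
      funext j; fin_cases j <;> simp [octMul]
    have := congrArg ((g : Matrix (Fin 8) (Fin 8) k) *ᵥ ·) h23
    simp only [hg.1 _ _, h4, hab, hcd] at this
    simpa [octMul] using congrFun this 4
  intro g hg h4
  obtain ⟨a, b, c, d, hdet, hab, -⟩ := shape g hg h4
  obtain ⟨n, hn, hn4, hn2⟩ := exists_mem_stdGens_mulVec_eq_single (a := a) (b := b) (by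
    by_contra! hc
    simp [hc.1, hc.2] at hdet)
  have hng4 : ((n * g : GL (Fin 8) k) : Matrix (Fin 8) (Fin 8) k) *ᵥ Pi.single 4 1 =
      Pi.single 4 1 := by
    rw [Units.val_mul, ← Matrix.mulVec_mulVec, h4, hn4]
  have hng2 : ((n * g : GL (Fin 8) k) : Matrix (Fin 8) (Fin 8) k) *ᵥ Pi.single 2 1 =
      Pi.single 2 1 := by
    rw [Units.val_mul, ← Matrix.mulVec_mulVec, hab, hn2]
  rw [← Subgroup.mul_mem_cancel_left _ hn]
  have hng := mul_mem (stdGens_le hn) hg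
  revert hng hng2 hng4
  generalize n * g = g
  intro h4 h2 hg
  obtain ⟨a, b, c, d, hdet, hab, hcd⟩ := shape g hg h4
  rw [h2] at hab
  have ha : a = 1 := by simpa using (congrFun hab 2).symm
  have hb : b = 0 := by simpa using (congrFun hab 3).symm
  have hd : d = 1 := by simpa [ha, hb] using hdet
  -- Once the vector 2 is fixed as well, only a shear by `c` is left, and it is undone by `exp (-c
  -- e)`.
  have hm := nilExpUnit_mem_stdGens (k := k) 0 (by decide) (-c)
  rw [← Subgroup.mul_mem_cancel_left _ hm]
  have : nilExpUnit (stabMat (Pi.single 0 1)) (stabMat_single_nil 0 (by decide)) (-c) * g = 1 := by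
    have hmem := mul_mem (stdGens_le hm) hg
    refine eq_one_of_fixes hmem.1 ?_
    rintro i (rfl | rfl | rfl | rfl)
    · simpa [stdVec_eq] using hmem.2
    · rw [Units.val_mul, ← Matrix.mulVec_mulVec, h2, coe_nilExpUnit]
      funext j; fin_cases j <;> (simp only [nilExp_mulVec_apply, stabMat_mulVec]; simp)
    · rw [Units.val_mul, ← Matrix.mulVec_mulVec, hcd, hd, coe_nilExpUnit]
      funext j; fin_cases j <;> simp [nilExp_mulVec_apply, stabMat_mulVec]
    · rw [Units.val_mul, ← Matrix.mulVec_mulVec, h4, coe_nilExpUnit]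
      funext j; fin_cases j <;> (simp only [nilExp_mulVec_apply, stabMat_mulVec]; simp)
  rw [this]
  exact one_mem _

lemma coe_stdBasis (i : Fin 8) :
    (stdBasis k i : Matrix (Fin 8) (Fin 8) k) = stabMat (Pi.single i 1) := by
  rw [stdBasis_apply, coe_stabEquiv]

lemma isFrame_stdBasis : IsFrame (stdGroup k) (stdBasis k) where
  rel := semidirectRelations_stdBasis
  nil i hi := by simpa only [coe_stdBasis] using stabMat_single_nil i hi
  mem i hi t := by
    simp only [coe_stdBasis]
    exact nilExpUnit_stabMat_mem _ t
  le_closure := by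
    simp only [coe_stdBasis]
    exact stdGroup_le_stdGens

end Generation

/-! ### Orbits of the group on traceless octonions -/

section Orbits

variable {k : Type*} [Field k]

/-- Two octonions in the same orbit of the group of type `G₂`. -/
def OctReach (x y : Fin 8 → k) : Prop :=
  ∃ g ∈ groupG2 k, (g : Matrix (Fin 8) (Fin 8) k) *ᵥ x = y

lemma OctReach.refl (x : Fin 8 → k) : OctReach x x := ⟨1, one_mem _, by simp⟩

lemma OctReach.trans {x y z : Fin 8 → k} (h : OctReach x y) (h' : OctReach y z) :
    OctReach x z := by
  obtain ⟨g, hg, rfl⟩ := h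
  obtain ⟨g', hg', rfl⟩ := h'
  exact ⟨g' * g, mul_mem hg' hg, by rw [Units.val_mul, ← Matrix.mulVec_mulVec]⟩

lemma OctReach.smul {x y : Fin 8 → k} (h : OctReach x y) (c : k) :
    OctReach (c • x) (c • y) := by
  obtain ⟨g, hg, rfl⟩ := h
  exact ⟨g, hg, by rw [Matrix.mulVec_smul]⟩

lemma OctReach.of_linearMap (f : (Fin 8 → k) →ₗ[k] (Fin 8 → k)) (n : ℕ)
    (hf : f ^ (n + 1) = 1)
    (h : ∀ x y, f (octMul x y) = octMul (f x) (f y)) (x : Fin 8 → k) : OctReach x (f x) := by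
  have hm : ∀ p q : (Fin 8 → k) →ₗ[k] (Fin 8 → k), p * q = 1 →
      LinearMap.toMatrix' p * LinearMap.toMatrix' q = 1 := fun p q hpq => by
    rw [← LinearMap.toMatrix'_mul, hpq, LinearMap.toMatrix'_one]
  refine ⟨⟨LinearMap.toMatrix' f, LinearMap.toMatrix' (f ^ n), hm _ _ ?_, hm _ _ ?_⟩, ?_, ?_⟩
  · rw [← pow_succ', hf]
  · rw [← pow_succ, hf]
  · intro x y
    simpa using h x y
  · simp

/-- The automorphism of order two of the octonions that exchanges the diagonal idempotents. -/
def octFlip (k : Type*) [Field k] : (Fin 8 → k) →ₗ[k] (Fin 8 → k) where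
  toFun x := ![x 7, -x 4, -x 5, -x 6, -x 1, -x 2, -x 3, x 0]
  map_add' x y := by funext i; fin_cases i <;> simp <;> ring
  map_smul' c x := by funext i; fin_cases i <;> simp

/-- The automorphism of order three of the octonions that permutes coordinates cyclically. -/
def octRot (k : Type*) [Field k] : (Fin 8 → k) →ₗ[k] (Fin 8 → k) where
  toFun x := ![x 0, x 2, x 3, x 1, x 5, x 6, x 4, x 7]
  map_add' x y := by funext i; fin_cases i <;> simp
  map_smul' c x := by funext i; fin_cases i <;> simp

lemma octReach_octFlip (x : Fin 8 → k) : OctReach x (octFlip k x) := by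
  refine .of_linearMap _ 1 ?_ ?_ x
  · refine LinearMap.ext fun x => ?_
    funext i
    fin_cases i <;> simp [pow_succ, octFlip]
  · intro x y
    funext i
    fin_cases i <;> simp [octFlip, octMul] <;> ring

lemma octReach_octRot (x : Fin 8 → k) : OctReach x (octRot k x) := by
  refine .of_linearMap _ 2 ?_ ?_ x
  · refine LinearMap.ext fun x => ?_
    funext i
    fin_cases i <;> simp [pow_succ, octRot]
  · intro x y
    funext i
    fin_cases i <;> simp [octRot, octMul] <;> ring

variable [CharZero k]

lemma StdReach.octReach {x y : Fin 8 → k} (h : StdReach x y) : OctReach x y := by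
  obtain ⟨g, hg, hxy⟩ := h
  exact ⟨g, (stdGens_le hg).1, hxy⟩

/-- Representatives, up to scalars, of the orbits in the traceless octonions. -/
def IsOrbitRep (y : Fin 8 → k) : Prop :=
  y = stdVec k ∨ y = ![1, 0, 0, 0, 0, 0, 0, -1]

lemma exists_octReach_of_four_ne_zero [IsAlgClosed k] {x : Fin 8 → k} (h7 : x 7 = -x 0)
    (h4 : x 4 ≠ 0) : ∃ y, IsOrbitRep y ∧ ∃ c : k, c ≠ 0 ∧ OctReach x (c • y) := by
  set y := (x 4)⁻¹ • x with hy
  have hxy : x = x 4 • y := by rw [hy, smul_smul, mul_inv_cancel₀ h4, one_smul]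
  have y4 : y 4 = 1 := by simp [hy, h4]
  have y7 : y 7 = -y 0 := by simp [hy, h7]
  -- A square root of the scalar `y ^ 2`: it separates the nilpotent orbit (`c = 0`) from the
  -- semisimple ones.
  obtain ⟨c, hc⟩ := IsAlgClosed.exists_pow_nat_eq
    (y 0 ^ 2 + (y 1 * y 4 + y 2 * y 5 + y 3 * y 6)) (n := 2) (by norm_num)
  have h1 := (StdReach.exists_sqrt y4 y7 c (by rw [hc, octMul_self_of_traceZero y7])).octReach.trans
    (octReach_octFlip _)
  suffices ∃ z, IsOrbitRep z ∧ ∃ d : k, d ≠ 0 ∧ OctReach y (d • z) by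
    obtain ⟨z, hz, d, hd, h⟩ := this
    refine ⟨z, hz, x 4 * d, mul_ne_zero h4 hd, ?_⟩
    have := h.smul (x 4)
    rwa [← hxy, smul_smul] at this
  by_cases hc0 : c = 0
  · refine ⟨_, .inl rfl, -1, by simp, ?_⟩
    convert h1 using 1
    funext i
    fin_cases i <;> simp [stdVec, octFlip, hc0]
  · refine ⟨_, .inr rfl, -c, by simpa using hc0, h1.trans ?_⟩
    -- After the flip the vector is `(-c, -1, 0, 0, 0, 0, 0, c)`. Here `exp (t u)` adds `-4 * c * t`
    -- to the coordinate 1, so this `t` cancels the `-1`.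
    convert (StdReach.single 5 (by decide) (-1 / (4 * c)) _).octReach using 1
    funext i
    fin_cases i <;> (simp only [octFlip, nilExp_mulVec_apply, stabMat_mulVec]; simp)
    field_simp
    norm_num

/-- Cyclic rotation and the flip bring any non-zero off-diagonal coordinate to index 4; otherwise
`x` is already diagonal. -/
lemma exists_octReach [IsAlgClosed k] {x : Fin 8 → k} (h7 : x 7 = -x 0) (hx : x ≠ 0) :
    ∃ y, IsOrbitRep y ∧ ∃ c : k, c ≠ 0 ∧ OctReach x (c • y) := by
  have main : ∀ z, OctReach x z → z 7 = -z 0 → z 4 ≠ 0 →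
      ∃ y, IsOrbitRep y ∧ ∃ c : k, c ≠ 0 ∧ OctReach x (c • y) := fun z hz z7 z4 => by
    obtain ⟨y, hy, c, hc, h⟩ := exists_octReach_of_four_ne_zero z7 z4
    exact ⟨y, hy, c, hc, hz.trans h⟩
  have main' : ∀ z, OctReach x z → z 7 = -z 0 → (z 4 ≠ 0 ∨ z 5 ≠ 0 ∨ z 6 ≠ 0) →
      ∃ y, IsOrbitRep y ∧ ∃ c : k, c ≠ 0 ∧ OctReach x (c • y) := by
    rintro z hz z7 (h | h | h)
    · exact main z hz z7 h
    · exact main _ (hz.trans (octReach_octRot z)) (by simpa [octRot] using z7)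
        (by simpa [octRot] using h)
    · exact main _ ((hz.trans (octReach_octRot z)).trans (octReach_octRot _))
        (by simpa [octRot] using z7) (by simpa [octRot] using h)
  by_cases h : x 4 ≠ 0 ∨ x 5 ≠ 0 ∨ x 6 ≠ 0
  · exact main' x (.refl x) h7 h
  by_cases h' : x 1 ≠ 0 ∨ x 2 ≠ 0 ∨ x 3 ≠ 0
  · exact main' _ (octReach_octFlip x) (by simp [octFlip, h7]) (by simpa [octFlip] using h')
  push Not at h h'
  refine ⟨_, .inr rfl, x 0, fun h0 => hx ?_, ?_⟩
  · funext i
    fin_cases i <;> simp [h, h', h0, h7]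
  · convert OctReach.refl x using 1
    funext i
    fin_cases i <;> simp [h, h', h7]

end Orbits

/-! ### Short root derivations as a standard module of `sl₃` -/

section ShortRoots

variable {k : Type*} [Field k]

/-- The nilpotent derivations attached to the short roots that move the diagonal. -/
def shortMat (p : Fin 3 → k) : Matrix (Fin 8) (Fin 8) k :=
  !![0, 0, 0, 0, -p 0, -p 1, -p 2, 0;
    p 0, 0, 0, 0, 0, 0, 0, -p 0;
    p 1, 0, 0, 0, 0, 0, 0, -p 1;
    p 2, 0, 0, 0, 0, 0, 0, -p 2;
    0, 0, -p 2, p 1, 0, 0, 0, 0;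
    0, p 2, 0, -p 0, 0, 0, 0, 0;
    0, -p 1, p 0, 0, 0, 0, 0, 0;
    0, 0, 0, 0, p 0, p 1, p 2, 0]

lemma shortMat_mulVec (p : Fin 3 → k) (x : Fin 8 → k) : shortMat p *ᵥ x =
    ![-(p 0 * x 4 + p 1 * x 5 + p 2 * x 6), (x 0 - x 7) * p 0, (x 0 - x 7) * p 1,
      (x 0 - x 7) * p 2, p 1 * x 3 - p 2 * x 2, p 2 * x 1 - p 0 * x 3, p 0 * x 2 - p 1 * x 1,
      p 0 * x 4 + p 1 * x 5 + p 2 * x 6] := by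
  funext i
  fin_cases i <;> simp [shortMat, Matrix.mulVec, dotProduct, Fin.sum_univ_eight] <;> ring

lemma isDer_shortMat (p : Fin 3 → k) : IsDer (shortMat p) := by
  intro x y
  simp only [shortMat_mulVec]
  funext i
  fin_cases i <;> simp [octMul] <;> ring

lemma shortMat_nil (p : Fin 3 → k) : shortMat p * shortMat p * shortMat p = 0 := by
  refine Matrix.toLin'.injective (LinearMap.ext fun x => ?_)
  rw [Matrix.toLin'_apply, ← Matrix.mulVec_mulVec, ← Matrix.mulVec_mulVec]
  simp only [shortMat_mulVec]
  funext i
  fin_cases i <;> simp [-mul_eq_zero] <;> ring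

lemma shortMat_mem_lieAlg [CharZero k] (p : Fin 3 → k) : shortMat p ∈ lieAlg (groupG2 k) :=
  mem_lieAlg_of_nilExpUnit_mem (shortMat_nil p) fun t =>
    nilExpUnit_mem_groupG2 (isDer_shortMat p) (shortMat_nil p) t

lemma blockMat_mulVec (A : Matrix (Fin 3) (Fin 3) k) (x : Fin 8 → k) : blockMat A *ᵥ x =
    ![0, A 0 0 * x 1 + A 0 1 * x 2 + A 0 2 * x 3, A 1 0 * x 1 + A 1 1 * x 2 + A 1 2 * x 3,
      A 2 0 * x 1 + A 2 1 * x 2 + A 2 2 * x 3, -(A 0 0 * x 4 + A 1 0 * x 5 + A 2 0 * x 6),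
      -(A 0 1 * x 4 + A 1 1 * x 5 + A 2 1 * x 6), -(A 0 2 * x 4 + A 1 2 * x 5 + A 2 2 * x 6),
      0] := by
  funext i
  fin_cases i <;> simp [blockMat, Matrix.mulVec, dotProduct, Fin.sum_univ_eight] <;> ring

/-- Through this equivariance an eigenvector of `A` in `k³` yields a derivation whose line is
normalized by `blockMat A`. -/
lemma lie_blockMat_shortMat {A : Matrix (Fin 3) (Fin 3) k} (hA : A.trace = 0) (p : Fin 3 → k) :
    ⁅blockMat A, shortMat p⁆ = shortMat (A *ᵥ p) := by
  rw [Matrix.trace_fin_three] at hA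
  refine Matrix.toLin'.injective (LinearMap.ext fun x => ?_)
  rw [Ring.lie_def, Matrix.toLin'_apply, Matrix.toLin'_apply, Matrix.sub_mulVec,
    ← Matrix.mulVec_mulVec, ← Matrix.mulVec_mulVec]
  simp only [shortMat_mulVec, blockMat_mulVec, Matrix.mulVec, dotProduct, Fin.sum_univ_three]
  have h : A 2 2 = -A 0 0 - A 1 1 := by linear_combination hA
  funext i
  fin_cases i <;> simp [h] <;> ring

end ShortRoots

/-! ### Maximal solvable subalgebras and Lie's theorem -/

section Borel

variable {k : Type*} [Field k] {L : Type*} [LieRing L] [LieAlgebra k L]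

/-- An extension of a solvable Lie algebra by an abelian ideal is solvable. -/
lemma isSolvable_of_quotient (I : LieIdeal k L) [IsLieAbelian I]
    [LieAlgebra.IsSolvable (L ⧸ I)] : LieAlgebra.IsSolvable L := by
  obtain ⟨N, hN⟩ := LieAlgebra.IsSolvable.solvable (R := k) (L := L ⧸ I)
  let f : L →ₗ⁅k⁆ L ⧸ I :=
    { (LieSubmodule.Quotient.mk' I : L →ₗ[k] L ⧸ I) with map_lie' := rfl }
  have h1 : LieAlgebra.derivedSeries k L N ≤ I := by
    intro x hx
    have h2 : f x ∈ (LieAlgebra.derivedSeries k L N).map f := LieIdeal.mem_map hx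
    have h3 := LieIdeal.derivedSeries_map_le (f := f) N h2
    rw [hN] at h3
    exact (LieSubmodule.Quotient.mk_eq_zero' (N := I)).1 h3
  refine LieAlgebra.IsSolvable.mk (R := k) (k := 1 + N) ?_
  rw [LieAlgebra.derivedSeries_def, LieAlgebra.derivedSeriesOfIdeal_add, eq_bot_iff]
  refine (LieAlgebra.derivedSeriesOfIdeal_mono h1 1).trans ?_
  rw [(LieAlgebra.abelian_iff_derived_one_eq_bot I).1 inferInstance]

/-- A Borel subalgebra contains every element whose line it normalizes. -/
lemma IsBorel.mem_of_lie_eq_smul {b : LieSubalgebra k L} (hb : IsBorel b) {D : L}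
    (hD : ∀ X ∈ b, ∃ c : k, ⁅X, D⁆ = c • D) : D ∈ b := by
  -- The sum `b + kD` is a subalgebra with abelian ideal `kD`, and the quotient by it is an image of
  -- `b`. So the sum is solvable, and maximality of `b` applies.
  let c : LieSubalgebra k L :=
    { b.toSubmodule ⊔ Submodule.span k {D} with
      lie_mem' := by
        intro X Y hX hY
        simp only [AddSubsemigroup.mem_carrier, AddSubmonoid.mem_toSubsemigroup,
          Submodule.mem_toAddSubmonoid, Submodule.mem_sup, Submodule.mem_span_singleton] at hX hY ⊢
        obtain ⟨x, hx, _, ⟨s, rfl⟩, rfl⟩ := hX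
        obtain ⟨y, hy, _, ⟨t, rfl⟩, rfl⟩ := hY
        obtain ⟨p, hp⟩ := hD x hx
        obtain ⟨q, hq⟩ := hD y hy
        refine ⟨⁅x, y⁆, b.lie_mem hx hy, _, ⟨t * p - s * q, rfl⟩, ?_⟩
        have hq' : ⁅D, y⁆ = -(q • D) := by rw [← hq, lie_skew]
        simp [hp, hq', mul_smul, sub_smul]
        abel }
  have hmem : ∀ X, X ∈ c ↔ ∃ x ∈ b, ∃ s : k, x + s • D = X := fun X => by
    change X ∈ b.toSubmodule ⊔ Submodule.span k {D} ↔ _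
    simp [Submodule.mem_sup, Submodule.mem_span_singleton]
  have hbc : b ≤ c := fun x hx => (hmem x).2 ⟨x, hx, 0, by simp⟩
  have hDc : D ∈ c := (hmem D).2 ⟨0, zero_mem _, 1, by simp⟩
  let I : LieIdeal k c :=
    { Submodule.span k {(⟨D, hDc⟩ : c)} with
      lie_mem := by
        intro X Y hY
        simp only [AddSubsemigroup.mem_carrier, AddSubmonoid.mem_toSubsemigroup,
          Submodule.mem_toAddSubmonoid, Submodule.mem_span_singleton] at hY ⊢
        obtain ⟨t, rfl⟩ := hY
        obtain ⟨x, hx, s, hs⟩ := (hmem X).1 X.2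
        obtain ⟨p, hp⟩ := hD x hx
        refine ⟨t * p, Subtype.ext ?_⟩
        simp [← hs, hp, mul_smul] }
  have hI : ∀ X, X ∈ I ↔ ∃ t : k, t • (⟨D, hDc⟩ : c) = X := fun X =>
    Submodule.mem_span_singleton
  have : IsLieAbelian I := ⟨fun ⟨X, hX⟩ ⟨Y, hY⟩ => by
    obtain ⟨s, rfl⟩ := (hI X).1 hX
    obtain ⟨t, rfl⟩ := (hI Y).1 hY
    exact Subtype.ext (Subtype.ext (by simp))⟩
  have : LieAlgebra.IsSolvable b := hb.1
  let f : b →ₗ⁅k⁆ c ⧸ I :=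
    { (LieSubmodule.Quotient.mk' I : c →ₗ[k] c ⧸ I) ∘ₗ Submodule.inclusion hbc with
      map_lie' := rfl }
  have hf : Function.Surjective f := by
    intro y
    obtain ⟨X, rfl⟩ := LieSubmodule.Quotient.surjective_mk' I y
    obtain ⟨x, hx, s, hs⟩ := (hmem X).1 X.2
    refine ⟨⟨x, hx⟩, ?_⟩
    refine (Submodule.Quotient.eq _).2 ((hI _).2 ⟨-s, Subtype.ext ?_⟩)
    change -s • D = x - X
    rw [← hs]
    simp
  have : LieAlgebra.IsSolvable (c ⧸ I) := hf.lieAlgebra_isSolvable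
  exact hb.2 (isSolvable_of_quotient I) hbc hDc

/-- A solvable Lie algebra of endomorphisms over an algebraically closed field of characteristic
zero has a common eigenvector. -/
lemma exists_common_eigenvector [IsAlgClosed k] [CharZero k] [LieAlgebra.IsSolvable L]
    {V : Type*} [AddCommGroup V] [Module k V] [Module.Finite k V] [Nontrivial V]
    (ρ : L →ₗ⁅k⁆ Module.End k V) : ∃ p : V, p ≠ 0 ∧ ∀ X, ∃ c : k, ρ X p = c • p := by
  let _ := LieRingModule.compLieHom V ρ
  let _ := LieModule.compLieHom V ρ
  obtain ⟨χ, h⟩ := LieModule.exists_nontrivial_weightSpace_of_isSolvable k L V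
  obtain ⟨⟨p, hp⟩, hp0⟩ := exists_ne (0 : LieModule.weightSpace V χ)
  refine ⟨p, fun h => hp0 (Subtype.ext h), fun X => ⟨χ X, ?_⟩⟩
  exact (LieModule.mem_weightSpace _ _).1 hp X

end Borel

/-! ### Highest weight vectors are nilpotent octonions -/

section Highest

variable {k : Type*} [Field k]

lemma conj_lie {n : Type*} [Fintype n] [DecidableEq n] (g : GL n k) (X Y : Matrix n n k) :
    (g : Matrix n n k) * ⁅X, Y⁆ * ((g⁻¹ : GL n k) : Matrix n n k) =
      ⁅(g : Matrix n n k) * X * ((g⁻¹ : GL n k) : Matrix n n k),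
        (g : Matrix n n k) * Y * ((g⁻¹ : GL n k) : Matrix n n k)⁆ := by
  simp only [Ring.lie_def, mul_sub, sub_mul, mul_assoc, Units.inv_mul_cancel_left]

lemma blockMat_submatrix (A : Matrix (Fin 3) (Fin 3) k) :
    (blockMat A).submatrix ![1, 2, 3] ![1, 2, 3] = A := by
  ext i j
  fin_cases i <;> fin_cases j <;> simp [blockMat]

lemma blockMat_mul_submatrix (A B : Matrix (Fin 3) (Fin 3) k) :
    (blockMat A * blockMat B).submatrix ![1, 2, 3] ![1, 2, 3] = A * B := by
  ext i j
  fin_cases i <;> fin_cases j <;>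
    simp [blockMat, Matrix.mul_apply, Fin.sum_univ_three, add_assoc]

lemma shortMat_smul (c : k) (p : Fin 3 → k) : shortMat (c • p) = c • shortMat p := by
  ext i j
  fin_cases i <;> fin_cases j <;> simp [shortMat]

variable [CharZero k]

/-- A derivation of the octonions with the eigenvector `diag (1, -1)` kills the diagonal. -/
lemma IsDer.apply_zero_of_eigenvector {X : Matrix (Fin 8) (Fin 8) k} (h : IsDer X) {c : k}
    (hc : X *ᵥ ![1, 0, 0, 0, 0, 0, 0, -1] = c • ![1, 0, 0, 0, 0, 0, 0, -1]) (i : Fin 8) :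
    X i 0 = 0 := by
  have h1 := h.mulVec_octOne
  have h2 := h (Pi.single 0 1) (Pi.single 0 1)
  have e0 : octMul (Pi.single 0 (1 : k)) (Pi.single 0 1) = Pi.single 0 1 := by
    funext i; fin_cases i <;> simp [octMul]
  rw [e0, Matrix.mulVec_single_one] at h2
  have a0 := congrFun h1
  have b0 := congrFun hc
  simp [octOne, Matrix.mulVec, dotProduct, Fin.sum_univ_eight] at a0 b0
  have q0 := congrFun h2 0
  simp [octMul] at q0
  have hA : ∀ i, X i 0 + X i 7 = 0 := a0
  -- Idempotency of the basis vector 0 gives `X 0 0 = 0`; together with `X 1 = 0` the eigenvalue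
  -- vanishes. Then `X` kills both the identity and `diag (1, -1)`, hence that vector.
  have hc0 : c = 0 := by
    have := b0 0
    simp at this
    linear_combination -this + 2 * q0 - a0 0
  have := b0 i
  rw [hc0] at this
  simp at this
  have h2 : (2 : k) * X i 0 = 0 := by linear_combination this + hA i
  simpa using h2

/-- The short root vectors of the split octonions do not have `diag (1, -1)` as an eigenvector. -/
lemma shortMat_mulVec_diag_ne {p : Fin 3 → k} (hp : p ≠ 0) (c : k) :
    shortMat p *ᵥ ![1, 0, 0, 0, 0, 0, 0, -1] ≠ c • ![1, 0, 0, 0, 0, 0, 0, -1] := by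
  intro h
  rw [shortMat_mulVec] at h
  have h2 : ∀ a : k, (1 - -1) * a = 0 → a = 0 := fun a ha => by
    norm_num at ha
    exact ha
  have h3 : ∀ i, (1 - -1) * p i = 0 := by
    have h' := congrFun h
    intro i
    fin_cases i
    · simpa using h' 1
    · simpa using h' 2
    · simpa using h' 3
  exact hp (funext fun i => h2 _ (h3 i))

/-- Highest weight vectors are conjugate to multiples of the standard one. -/
lemma IsHighestWeightVector.octReach [IsAlgClosed k] {v : Fin 8 → k} (hv : v ∈ traceZero k)
    (hw : IsHighestWeightVector (groupG2 k) v) : ∃ c : k, c ≠ 0 ∧ OctReach v (c • stdVec k) := by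
  obtain ⟨hv0, b, hb, hbv⟩ := hw
  have h7 : v 7 = -v 0 := eq_neg_of_add_eq_zero_right hv
  obtain ⟨y, rfl | rfl, c, hc, hr⟩ := exists_octReach h7 hv0
  · exact ⟨c, hc, hr⟩
  exfalso
  obtain ⟨g, hg, hgv⟩ := hr
  set w : Fin 8 → k := ![1, 0, 0, 0, 0, 0, 0, -1] with hwdef
  set A := adjointRep (groupG2 k)
  have hgi : ((g⁻¹ : GL (Fin 8) k) : Matrix (Fin 8) (Fin 8) k) * (g : Matrix (Fin 8) (Fin 8) k) = 1 :=
    g.inv_mul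
  have hw : ((g⁻¹ : GL (Fin 8) k) : Matrix (Fin 8) (Fin 8) k) *ᵥ w = c⁻¹ • v := by
    have : w = c⁻¹ • ((g : Matrix (Fin 8) (Fin 8) k) *ᵥ v) := by
      rw [hgv, smul_smul, inv_mul_cancel₀ hc, one_smul]
    rw [this, Matrix.mulVec_smul, Matrix.mulVec_mulVec, hgi, Matrix.one_mulVec]
  -- Conjugated by `g`, the Borel subalgebra has `w` as a common eigenvector, so it lies in the copy
  -- of `sl₃`.
  have hA : ∀ X ∈ b, ∃ M : Matrix (Fin 3) (Fin 3) k, M.trace = 0 ∧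
      (A ⟨g, hg⟩ X : Matrix (Fin 8) (Fin 8) k) = blockMat M := fun X hX => by
    have hd : IsDer (A ⟨g, hg⟩ X : Matrix (Fin 8) (Fin 8) k) :=
      isDer_of_mem_lieAlg le_rfl (A ⟨g, hg⟩ X).2
    obtain ⟨μ, hμ⟩ := hbv X hX
    refine exists_eq_blockMat_of_isDer hd (hd.apply_zero_of_eigenvector (c := μ) ?_)
    change ((g : Matrix (Fin 8) (Fin 8) k) * (X : Matrix (Fin 8) (Fin 8) k) *
      ((g⁻¹ : GL (Fin 8) k) : Matrix (Fin 8) (Fin 8) k)) *ᵥ w = μ • w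
    rw [← Matrix.mulVec_mulVec, ← Matrix.mulVec_mulVec, hw, Matrix.mulVec_smul, hμ,
      smul_comm, Matrix.mulVec_smul, Matrix.mulVec_smul, hgv, smul_smul c⁻¹, inv_mul_cancel₀ hc,
      one_smul]
  have hlie : ∀ X Y : lieAlg (groupG2 k), A ⟨g, hg⟩ ⁅X, Y⁆ = ⁅A ⟨g, hg⟩ X, A ⟨g, hg⟩ Y⁆ := by
    exact fun X Y => Subtype.ext (conj_lie g X Y)
  let r : Matrix (Fin 8) (Fin 8) k →ₗ[k] Module.End k (Fin 3 → k) :=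
    { toFun M := Matrix.toLin' (M.submatrix ![1, 2, 3] ![1, 2, 3])
      map_add' M N := map_add Matrix.toLin' (M.submatrix _ _) (N.submatrix _ _)
      map_smul' c M := map_smul Matrix.toLin' c (M.submatrix _ _) }
  -- The block extraction `r` is multiplicative only on matrices of the form `blockMat`, which is
  -- why compatibility with brackets uses `hA`.
  let ρ : b →ₗ⁅k⁆ Module.End k (Fin 3 → k) :=
    { r ∘ₗ (lieAlg (groupG2 k)).toSubmodule.subtype ∘ₗ A ⟨g, hg⟩ ∘ₗ b.toSubmodule.subtype with
      map_lie' := by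
        intro X Y
        obtain ⟨M, -, hM⟩ := hA X X.2
        obtain ⟨N, -, hN⟩ := hA Y Y.2
        change r (A ⟨g, hg⟩ ⁅(X : lieAlg (groupG2 k)), (Y : lieAlg (groupG2 k))⁆) =
          ⁅r (A ⟨g, hg⟩ X), r (A ⟨g, hg⟩ Y)⁆
        rw [hlie, LieSubalgebra.coe_bracket, hM, hN]
        change Matrix.toLin' ((blockMat M * blockMat N).submatrix ![1, 2, 3] ![1, 2, 3] -
            (blockMat N * blockMat M).submatrix ![1, 2, 3] ![1, 2, 3]) =
          ⁅Matrix.toLin' ((blockMat M).submatrix ![1, 2, 3] ![1, 2, 3]),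
            Matrix.toLin' ((blockMat N).submatrix ![1, 2, 3] ![1, 2, 3])⁆
        rw [blockMat_mul_submatrix, blockMat_mul_submatrix, blockMat_submatrix,
          blockMat_submatrix, map_sub, Matrix.toLin'_mul, Matrix.toLin'_mul]
        rfl }
  have : LieAlgebra.IsSolvable b := hb.1
  obtain ⟨p, hp, hpe⟩ := exists_common_eigenvector ρ
  set S : lieAlg (groupG2 k) := ⟨shortMat p, shortMat_mem_lieAlg p⟩
  set D : lieAlg (groupG2 k) := A ⟨g, hg⟩⁻¹ S
  have hAD : A ⟨g, hg⟩ D = S := Representation.self_inv_apply _ _ _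
  -- With `p` a common eigenvector in `k³`, the conjugated Borel subalgebra normalizes the line of
  -- `shortMat p`.
  have hD : D ∈ b := by
    refine hb.mem_of_lie_eq_smul fun X hX => ?_
    obtain ⟨μ, hμ⟩ := hpe ⟨X, hX⟩
    obtain ⟨M, hM0, hM⟩ := hA X hX
    refine ⟨μ, ?_⟩
    have hinj : Function.Injective (A ⟨g, hg⟩) := fun a b hab => by
      rw [← Representation.inv_self_apply A ⟨g, hg⟩ a, hab, Representation.inv_self_apply]
    refine hinj ?_
    rw [hlie, map_smul, hAD]
    refine Subtype.ext ?_
    change ⁅(A ⟨g, hg⟩ X : Matrix (Fin 8) (Fin 8) k), shortMat p⁆ = μ • shortMat p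
    rw [hM, lie_blockMat_shortMat hM0]
    change (A ⟨g, hg⟩ X : Matrix (Fin 8) (Fin 8) k).submatrix ![1, 2, 3] ![1, 2, 3] *ᵥ p =
      μ • p at hμ
    rw [hM, blockMat_submatrix] at hμ
    rw [hμ, shortMat_smul]
  obtain ⟨μ, hμ⟩ := hbv D hD
  refine shortMat_mulVec_diag_ne hp μ ?_
  change (S : Matrix (Fin 8) (Fin 8) k) *ᵥ w = μ • w
  rw [← hAD]
  change ((g : Matrix (Fin 8) (Fin 8) k) * (D : Matrix (Fin 8) (Fin 8) k) *
      ((g⁻¹ : GL (Fin 8) k) : Matrix (Fin 8) (Fin 8) k)) *ᵥ w = μ • w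
  rw [← Matrix.mulVec_mulVec, ← Matrix.mulVec_mulVec, hw, Matrix.mulVec_smul, hμ,
      smul_comm, Matrix.mulVec_smul, Matrix.mulVec_smul, hgv, smul_smul c⁻¹, inv_mul_cancel₀ hc,
      one_smul]

end Highest

/-! ### Transport of the frame to an arbitrary highest weight vector -/

section Conjugation

variable {k : Type*} [Field k]

lemma SemidirectRelations.map {L L' : Type*} [LieRing L] [LieAlgebra k L] [LieRing L']
    [LieAlgebra k L'] (φ : L →ₗ⁅k⁆ L') {e h f a₁ b₁ u a₂ b₂ : L}
    (r : SemidirectRelations (k := k) e h f a₁ b₁ u a₂ b₂) :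
    SemidirectRelations (k := k) (φ e) (φ h) (φ f) (φ a₁) (φ b₁) (φ u) (φ a₂) (φ b₂) := by
  obtain ⟨⟩ := r
  constructor <;> simp only [← LieHom.map_lie, ← map_smul, ← map_neg, *, map_zero]

variable {n : Type*} [Fintype n] [DecidableEq n]

lemma conj_mem_lieAlg_of_conj_mem {Q Q' : Subgroup (GL n k)} {g : GL n k}
    (hg : ∀ q ∈ Q, g * q * g⁻¹ ∈ Q') {X : Matrix n n k} (hX : X ∈ lieAlg Q) :
    (g : Matrix n n k) * X * ((g⁻¹ : GL n k) : Matrix n n k) ∈ lieAlg Q' := by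
  intro f hf
  let L : Matrix n n k →ₗ[k] Matrix n n k :=
    LinearMap.mulRight k ((g⁻¹ : GL n k) : Matrix n n k) ∘ₗ
      LinearMap.mulLeft k (g : Matrix n n k)
  have h : pull L f ∈ idealOf Q := by
    intro q hq
    rw [evalAt_pull]
    simpa [L] using hf (g * q * g⁻¹) (hg q hq)
  have := hX _ h
  rw [dirDeriv_pull] at this
  have h1 : L 1 = 1 := by
    simp only [L, LinearMap.comp_apply, LinearMap.mulLeft_apply, LinearMap.mulRight_apply, mul_one]
    exact g.mul_inv
  rw [h1] at this
  exact this

lemma nilExp_conj (g : GL n k) (X : Matrix n n k) (t : k) :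
    nilExp ((g : Matrix n n k) * X * ((g⁻¹ : GL n k) : Matrix n n k)) t =
      (g : Matrix n n k) * nilExp X t * ((g⁻¹ : GL n k) : Matrix n n k) := by
  simp [nilExp, mul_add, add_mul, mul_assoc]

/-- The Lie algebras of conjugate groups are isomorphic. -/
def lieAlgConj {Q Q' : Subgroup (GL n k)} (g : GL n k) (hg : ∀ q ∈ Q, g * q * g⁻¹ ∈ Q')
    (hg' : ∀ q ∈ Q', g⁻¹ * q * g ∈ Q) : lieAlg Q ≃ₗ⁅k⁆ lieAlg Q' where
  toFun X := ⟨_, conj_mem_lieAlg_of_conj_mem hg X.2⟩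
  map_add' X Y := Subtype.ext (by simp [mul_add, add_mul])
  map_smul' c X := Subtype.ext (by simp)
  map_lie' {X Y} := Subtype.ext (conj_lie g X Y)
  invFun X := ⟨_, conj_mem_lieAlg_of_conj_mem (g := g⁻¹) (by simpa using hg') X.2⟩
  left_inv X := Subtype.ext (by simp [mul_assoc])
  right_inv X := Subtype.ext (by simp [mul_assoc])

lemma IsFrame.exists_conj {Q Q' : Subgroup (GL (Fin 8) k)} [CharZero k] {g : GL (Fin 8) k}
    (hg : ∀ q ∈ Q, g * q * g⁻¹ ∈ Q') (hg' : ∀ q ∈ Q', g⁻¹ * q * g ∈ Q)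
    {B : Module.Basis (Fin 8) k (lieAlg Q)} (hB : IsFrame Q B) :
    ∃ B' : Module.Basis (Fin 8) k (lieAlg Q'), IsFrame Q' B' := by
  let E := lieAlgConj g hg hg'
  have hE : ∀ i, (B.map E.toLinearEquiv i : Matrix (Fin 8) (Fin 8) k) =
      (g : Matrix (Fin 8) (Fin 8) k) * (B i : Matrix (Fin 8) (Fin 8) k) *
        ((g⁻¹ : GL (Fin 8) k) : Matrix (Fin 8) (Fin 8) k) := fun i => by
    rw [Module.Basis.map_apply]
    rfl
  have hnil : ∀ i, i ≠ 1 → (B.map E.toLinearEquiv i : Matrix (Fin 8) (Fin 8) k) *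
      (B.map E.toLinearEquiv i) * (B.map E.toLinearEquiv i) = 0 := fun i hi => by
    have h : (B i : Matrix (Fin 8) (Fin 8) k) * ((B i : Matrix (Fin 8) (Fin 8) k) *
      (B i : Matrix (Fin 8) (Fin 8) k)) = 0 := by rw [← mul_assoc, hB.nil i hi]
    have h' : ∀ Y, (B i : Matrix (Fin 8) (Fin 8) k) * ((B i : Matrix (Fin 8) (Fin 8) k) *
        ((B i : Matrix (Fin 8) (Fin 8) k) * Y)) = 0 := fun Y => by
      rw [← mul_assoc, ← mul_assoc, hB.nil i hi, zero_mul]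
    simp only [hE, mul_assoc, Units.inv_mul_cancel_left, h', mul_zero]
  have hexp : ∀ i hi t, nilExpUnit _ (hnil i hi) t = g * nilExpUnit _ (hB.nil i hi) t * g⁻¹ :=
    fun i hi t => Units.ext (by
      simp only [coe_nilExpUnit, hE, nilExp_conj, Units.val_mul])
  refine ⟨B.map E.toLinearEquiv, ?_, hnil, fun i hi t => ?_, fun q hq => ?_⟩
  · simp only [Module.Basis.map_apply]
    exact hB.rel.map E.toLieHom
  · rw [hexp i hi t]
    exact hg _ (hB.mem i hi t)
  · have hle : Subgroup.closure {x | ∃ i hi t, x = nilExpUnit _ (hB.nil i hi) t} ≤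
        (Subgroup.closure {x | ∃ i hi t, x = nilExpUnit _ (hnil i hi) t}).comap
          (MulAut.conj g).toMonoidHom := by
      rw [Subgroup.closure_le]
      rintro _ ⟨i, hi, t, rfl⟩
      exact Subgroup.subset_closure ⟨i, hi, t, (hexp i hi t).symm⟩
    have := hle (hB.le_closure (hg' q hq))
    simpa [mul_assoc] using this

/-- The scalar `c` is harmless, since whatever fixes `w` fixes its multiples. -/
lemma OctReach.conj_isotropy {v w : Fin 8 → k} {c : k} {g : GL (Fin 8) k}
    (hg : g ∈ groupG2 k) (h : (g : Matrix (Fin 8) (Fin 8) k) *ᵥ v = c • w) {q : GL (Fin 8) k}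
    (hq : q ∈ isotropy (groupG2 k) w) : g⁻¹ * q * g ∈ isotropy (groupG2 k) v := by
  have hgi : ((g⁻¹ : GL (Fin 8) k) : Matrix (Fin 8) (Fin 8) k) * (g : Matrix (Fin 8) (Fin 8) k) = 1 :=
    g.inv_mul
  refine ⟨mul_mem (mul_mem (inv_mem hg) hq.1) hg, ?_⟩
  rw [Units.val_mul, Units.val_mul, ← Matrix.mulVec_mulVec, ← Matrix.mulVec_mulVec, h,
    Matrix.mulVec_smul, hq.2, ← h, Matrix.mulVec_mulVec, hgi, Matrix.one_mulVec]

lemma IsHighestWeightVector.exists_isFrame [IsAlgClosed k] [CharZero k] {v : Fin 8 → k}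
    (hv : v ∈ traceZero k) (hw : IsHighestWeightVector (groupG2 k) v) :
    ∃ B : Module.Basis (Fin 8) k (lieAlg (isotropy (groupG2 k) v)),
      IsFrame (isotropy (groupG2 k) v) B := by
  obtain ⟨c, hc, g, hg, hgv⟩ := hw.octReach hv
  refine IsFrame.exists_conj (g := g⁻¹) (fun q hq => ?_) (fun q hq => ?_) isFrame_stdBasis
  · rw [inv_inv]
    exact OctReach.conj_isotropy hg hgv hq
  · have hw : ((g⁻¹ : GL (Fin 8) k) : Matrix (Fin 8) (Fin 8) k) *ᵥ stdVec k = c⁻¹ • v := by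
      have hgi : ((g⁻¹ : GL (Fin 8) k) : Matrix (Fin 8) (Fin 8) k) *
        (g : Matrix (Fin 8) (Fin 8) k) = 1 := g.inv_mul
      have : stdVec k = c⁻¹ • ((g : Matrix (Fin 8) (Fin 8) k) *ᵥ v) := by
        rw [hgv, smul_smul, inv_mul_cancel₀ hc, one_smul]
      rw [this, Matrix.mulVec_smul, Matrix.mulVec_mulVec, hgi, Matrix.one_mulVec]
    exact OctReach.conj_isotropy (inv_mem hg) hw hq

end Conjugation

end G2Case

end

theorem lemma3p8 {k : Type*} [Field k] [IsAlgClosed k] [CharZero k] (v₁ : Fin 8 → k)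
    (hv₁ : v₁ ∈ G2Case.traceZero k)
    (hw : G2Case.IsHighestWeightVector (G2Case.groupG2 k) v₁)
    (Q : Subgroup (GL (Fin 8) k)) (hQ : Q = G2Case.isotropy (G2Case.groupG2 k) v₁) :
    G2Case.HasCodimTwoProperty Q ∧
    ∃ B : Module.Basis (Fin 8) k (G2Case.lieAlg Q),
      G2Case.SemidirectRelations (k := k) (B 0) (B 1) (B 2) (B 3) (B 4) (B 5) (B 6) (B 7) ∧
      ∃ h₁ h₂ : SymmetricAlgebra k (G2Case.lieAlg Q),
        h₁ = G2Case.quadraticInvariant (B 3) (B 4) (B 5) (B 6) (B 7) ∧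
        h₂ = G2Case.cubicInvariant (B 0) (B 1) (B 2) (B 3) (B 4) (B 5) (B 6) (B 7) ∧
        h₁ ∈ G2Case.homogeneousPart k (G2Case.lieAlg Q) 2 ∧
        h₂ ∈ G2Case.homogeneousPart k (G2Case.lieAlg Q) 3 ∧
        AlgebraicIndependent k ![h₁, h₂] ∧
        G2Case.coadjointInvariants Q = Algebra.adjoin k {h₁, h₂} := by
  subst hQ
  obtain ⟨B, hB⟩ := hw.exists_isFrame hv₁
  exact ⟨hB.hasCodimTwoProperty, B, hB.rel, _, _, rfl, rfl,
    G2Case.quadraticInvariant_mem_homogeneousPart _ _ _ _ _,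
    G2Case.cubicInvariant_mem_homogeneousPart _ _ _ _ _ _ _ _,
    G2Case.algebraicIndependent_invariants B, hB.coadjointInvariants_eq⟩
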